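/- Let $\mathcal B$ be a category with finite products and let $R$ be a commutative ring object in $\mathcal B$ (the ground ring). A vector bundle over $A\in\mathcal B$ is an $R$-module object $X\to A$ in $\mathcal B/A$ whose structure arrow can be pulled back along every arrow into $A$ (no condition if $\mathcal B$ has finite limits); maps of vector bundles are commutative squares that are fibrewise linear. Let $\pi:\mathcal X\to\mathcal B$ be the resulting fibration, with any cleavage. A fibrewise linear dual of $X\to A$ is a vector bundle $X^\dagger\to A$ with a bilinear pairing with $X$ under which, for every generalized point $a:T\to A$, the fibre $(X^\dagger)_a$ is the module of linear functionals on the fibre $X_a$, i.e. of linear maps over $T$ from $a^*X$ to $T\times R$. Suppose that $\mathcal B$ is such that every vector bundle has a fibrewise linear dual, and choose one for each $X$. Let $\mathcal X^*\to\mathcal B$ be the fibrewise dual fibration: it has the objects of $\mathcal X$; an arrow $X\to Y$ is a class, up to vertical isomorphism of the apex, of spans $X\xleftarrow{\,v\,}\cdot\xrightarrow{\,h\,}Y$ with $v$ vertical and $h$ Cartesian; and the chosen Cartesian lifts are the classes of $(1,h)$ with $h$ a chosen Cartesian lift in $\mathcal X$. The dualization functor $\dagger:\mathcal X\to\mathcal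 X^*$ over $\mathcal B$ sends $X$ to $X^\dagger$ and sends $t:X\to Y$ over $\alpha$ to the class of $X^\dagger\leftarrow\alpha^*(Y^\dagger)\to Y^\dagger$, whose left leg is the fibrewise transpose of $t$. For a fibration with cleavage over $\mathcal B$, $Q\in\mathcal B$ and $X$ over $M$, write $Q\otimes X=p^*X$ with $p:Q\times M\to M$ the projection. A strength on a functor $G$ over $\mathcal B$ between fibrations with cleavage is a family of vertical arrows $Q\otimes G(X)\to G(Q\otimes X)$, natural in $Q$ and $X$ and compatible with the canonical isomorphisms $1\otimes X\cong X$ and $(Q\times Q')\otimes X\cong Q\otimes(Q'\otimes X)$. In the identity fibration $\mathcal B\to\mathcal B$ one has $Q\otimes M=Q\times M$. Then: 1. $\dagger:\mathcal X\to\mathcal X^*$ is Cartesian, i.e. preserves Cartesian arrows. 2. The canonical comparison maps $(Q\otimes X)^\dagger\to Q\otimes X^\dagger$ in $\mathcal X^*$ are invertible, and their inverses $d_{Q,X}:Q\otimes X^\dagger\to(Q\otimes X)^\dagger$ form a strength on $\dagger$. 3. For every functor $F:\mathcal B\to\mathcal X$ over $\mathcal B$ and every strength $t_{Q,M}:Q\otimes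 F(M)\to F(Q\times M)$ on $F$, the composites $$Q\otimes F^\dagger(M)\xrightarrow{\;d_{Q,F(M)}\;}(Q\otimes F(M))^\dagger\xrightarrow{\;(t_{Q,M})^\dagger\;}F^\dagger(Q\times M)$$ in $\mathcal X^*$ form a strength on the star bundle functor $F^\dagger=\dagger\circ F:\mathcal B\to\mathcal X^*$. -/

import Mathlib

universe v u v₁ u₁ v₂ u₂

namespace StarBundle

open CategoryTheory Category Functor MonoidalCategory CartesianMonoidalCategory
open scoped CommRingObj

section Fibrations

variable {B : Type u} [Category.{v} B]

/-- A cleavage of `π`: a chosen Cartesian lift `α^*(Y) ⟶ Y` of every `α : A ⟶ π Y`.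
(Mathlib's strongly Cartesian arrows are the Cartesian arrows in the sense of Grothendieck
fibrations: unique factorization over every base arrow into the domain.) -/
structure Cleavage {𝒳 : Type u₁} [Category.{v₁} 𝒳] (π : 𝒳 ⥤ B) where
  obj : ∀ {A : B} (Y : 𝒳) (_ : A ⟶ π.obj Y), 𝒳
  map : ∀ {A : B} (Y : 𝒳) (α : A ⟶ π.obj Y), obj Y α ⟶ Y
  cartesian : ∀ {A : B} (Y : 𝒳) (α : A ⟶ π.obj Y), π.IsStronglyCartesian α (map Y α)

attribute [instance] Cleavage.cartesian

/-- The base category as fibred over itself by the identity functor. -/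
abbrev trivialFibration (B : Type u) [Category.{v} B] : BasedCategory.{v, u} B :=
  BasedCategory.ofFunctor (Functor.id B)

/-- The (only) cleavage of the identity fibration: `α^*(Y)` is the domain of `α`. -/
def trivialCleavage (B : Type u) [Category.{v} B] : Cleavage (trivialFibration B).p where
  obj {A} _ _ := A
  map _ α := α
  cartesian {A} Y α :=
    { toIsHomLift := CategoryTheory.IsHomLift.map (p := Functor.id B) α
      universal_property' := fun {a'} g φ' h => by
        refine ⟨g, ⟨CategoryTheory.IsHomLift.map (p := Functor.id B) g, ?_⟩, ?_⟩
        · exact @CategoryTheory.IsHomLift.eq_of_isHomLift _ _ _ _ _ _ _ _ _ h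
        · rintro χ ⟨hχ, -⟩
          exact (@CategoryTheory.IsHomLift.eq_of_isHomLift _ _ _ _ _ _ _ _ _ hχ).symm }

/-- A functor over `B` is Cartesian if it preserves Cartesian arrows. -/
def IsCartesianFunctor {𝒳 : BasedCategory.{v₁, u₁} B} {𝒴 : BasedCategory.{v₂, u₂} B}
    (F : 𝒳 ⥤ᵇ 𝒴) : Prop :=
  ∀ ⦃A A' : B⦄ (α : A ⟶ A') ⦃X X' : 𝒳.obj⦄ (h : X ⟶ X'),
    𝒳.p.IsStronglyCartesian α h → 𝒴.p.IsStronglyCartesian α (F.map h)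

/-! ### The fibrewise dual of a fibration -/

section FibrewiseDual

variable {𝒳 : Type u₁} [Category.{v₁} 𝒳] (π : 𝒳 ⥤ B)

/-- A span `X ⟵ apex ⟶ Y` with vertical left leg and Cartesian right leg. -/
structure VHSpan (X Y : 𝒳) where
  apex : 𝒳
  base : π.obj X ⟶ π.obj Y
  v : apex ⟶ X
  h : apex ⟶ Y
  vertical : π.IsHomLift (𝟙 (π.obj X)) v
  cartesian : π.IsStronglyCartesian base h

namespace VHSpan

attribute [instance] VHSpan.vertical VHSpan.cartesian

variable {π} {X Y Z W : 𝒳}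

/-- Two vh spans are equivalent if they differ by a vertical isomorphism of the apices. -/
def Equivalent (S S' : VHSpan π X Y) : Prop :=
  ∃ s : S'.apex ≅ S.apex, π.IsHomLift (𝟙 (π.obj X)) s.hom ∧
    s.hom ≫ S.v = S'.v ∧ s.hom ≫ S.h = S'.h

/-- `U` is a composite of the vh spans `S` and `T`:
there is a commutative square `w ≫ S.h = k ≫ T.v` with `w` vertical, `k` Cartesian over
the base of `S`, and `U = (w ≫ S.v, k ≫ T.h)`. -/
def IsComposite (S : VHSpan π X Y) (T : VHSpan π Y Z) (U : VHSpan π X Z) : Prop :=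
  ∃ (k : U.apex ⟶ T.apex) (w : U.apex ⟶ S.apex),
    π.IsStronglyCartesian S.base k ∧ π.IsHomLift (𝟙 (π.obj X)) w ∧
      w ≫ S.h = k ≫ T.v ∧ U.v = w ≫ S.v ∧ U.h = k ≫ T.h

theorem lift_unique (π : 𝒳 ⥤ B) {R R' : B} {a b : 𝒳} (f f' : R ⟶ R') (φ : a ⟶ b)
    [π.IsHomLift f φ] [π.IsHomLift f' φ] : f = f' :=
  (CategoryTheory.IsHomLift.fac π f φ).trans (CategoryTheory.IsHomLift.fac π f' φ).symm

theorem Equivalent.base_eq {S S' : VHSpan π X Y} (e : S.Equivalent S') : S.base = S'.base := by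
  obtain ⟨s, hs, -, h2⟩ := e
  have : π.IsHomLift S.base S'.h := by rw [← h2]; infer_instance
  exact lift_unique π S.base S'.base S'.h

theorem IsComposite.base_eq {S : VHSpan π X Y} {T : VHSpan π Y Z} {U : VHSpan π X Z}
    (h : IsComposite S T U) : U.base = S.base ≫ T.base := by
  obtain ⟨k, w, hk, hw, -, -, h2⟩ := h
  have : π.IsHomLift (S.base ≫ T.base) U.h := by rw [h2]; infer_instance
  exact lift_unique π U.base _ U.h

theorem Equivalent.refl (S : VHSpan π X Y) : S.Equivalent S :=
  ⟨Iso.refl _, CategoryTheory.IsHomLift.id (CategoryTheory.IsHomLift.domain_eq π (𝟙 (π.obj X)) S.v), by simp, by simp⟩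

theorem Equivalent.symm {S S' : VHSpan π X Y} (e : S.Equivalent S') : S'.Equivalent S := by
  obtain ⟨s, hs, h1, h2⟩ := e
  exact ⟨s.symm, by dsimp; infer_instance, by simp [← h1], by simp [← h2]⟩

theorem Equivalent.trans {S S' S'' : VHSpan π X Y} (e : S.Equivalent S')
    (e' : S'.Equivalent S'') : S.Equivalent S'' := by
  obtain ⟨s, hs, h1, h2⟩ := e
  obtain ⟨t, ht, h3, h4⟩ := e'
  exact ⟨t ≪≫ s, by dsimp; infer_instance, by simp [h1, h3], by simp [h2, h4]⟩

instance setoid (X Y : 𝒳) : Setoid (VHSpan π X Y) where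
  r := Equivalent
  iseqv := ⟨Equivalent.refl, Equivalent.symm, Equivalent.trans⟩

theorem IsComposite.equivalent {S S' : VHSpan π X Y} {T T' : VHSpan π Y Z} {U U' : VHSpan π X Z}
    (hU : IsComposite S T U) (hU' : IsComposite S' T' U')
    (eS : S.Equivalent S') (eT : T.Equivalent T') : U.Equivalent U' := by
  have hb := eS.base_eq
  obtain ⟨s, hs, s1, s2⟩ := eS
  obtain ⟨t, ht, t1, t2⟩ := eT
  obtain ⟨k, w, hk, hw, e1, e2, e3⟩ := hU
  obtain ⟨k', w', hk', hw', e1', e2', e3'⟩ := hU'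
  rw [← hb] at hk'
  have : π.IsStronglyCartesian (𝟙 (π.obj Y)) t.hom := inferInstance
  have hkt : π.IsStronglyCartesian S.base (k' ≫ t.hom) := by
    have := IsStronglyCartesian.comp π (f := S.base) (g := 𝟙 (π.obj Y)) (φ := k') (ψ := t.hom)
    simpa using this
  let e := IsCartesian.domainUniqueUpToIso π S.base k (k' ≫ t.hom)
  have he : e.hom ≫ k = k' ≫ t.hom := by simp [e]
  have hev : π.IsHomLift (𝟙 (π.obj X)) e.hom := inferInstance
  have hw2 : e.hom ≫ w = w' ≫ s.hom := by
    apply IsStronglyCartesian.ext π S.base S.h (𝟙 (π.obj X))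
    rw [assoc, e1, assoc, s2, e1', ← assoc, he, assoc, t1]
  refine ⟨e, hev, ?_, ?_⟩
  · rw [e2, e2', ← assoc, hw2, assoc, s1]
  · rw [e3, e3', ← assoc, he, assoc, t2]

variable (π) in
/-- The identity vh span. -/
def idSpan (X : 𝒳) : VHSpan π X X where
  apex := X
  base := 𝟙 _
  v := 𝟙 _
  h := 𝟙 _
  vertical := inferInstance
  cartesian := inferInstance

theorem isComposite_id_left (T : VHSpan π X Y) : IsComposite (idSpan π X) T T := by
  refine ⟨𝟙 _, T.v, ?_, T.vertical, by simp [idSpan], by simp [idSpan], by simp⟩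
  have : π.IsHomLift (𝟙 (π.obj X)) (𝟙 T.apex) :=
    CategoryTheory.IsHomLift.id (CategoryTheory.IsHomLift.domain_eq π (𝟙 (π.obj X)) T.v)
  exact IsStronglyCartesian.of_isIso π (𝟙 (π.obj X)) (𝟙 T.apex)

theorem isComposite_id_right (S : VHSpan π X Y) : IsComposite S (idSpan π Y) S :=
  ⟨S.h, 𝟙 _, S.cartesian, CategoryTheory.IsHomLift.id (CategoryTheory.IsHomLift.domain_eq π (𝟙 (π.obj X)) S.v),
    by simp [idSpan], by simp, by simp [idSpan]⟩

theorem isComposite_assoc {S : VHSpan π X Y} {T : VHSpan π Y Z} {U : VHSpan π Z W}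
    {P : VHSpan π X Z} {Q : VHSpan π Y W} {V : VHSpan π X W}
    (hP : IsComposite S T P) (hQ : IsComposite T U Q) (hV : IsComposite P U V) :
    IsComposite S Q V := by
  have hb := hP.base_eq
  obtain ⟨kP, wP, hkP, hwP, p1, p2, p3⟩ := hP
  obtain ⟨kQ, wQ, hkQ, hwQ, q1, q2, q3⟩ := hQ
  obtain ⟨kV, wV, hkV, hwV, v1, v2, v3⟩ := hV
  let k := IsStronglyCartesian.map π T.base kQ hb kV
  have hk : k ≫ kQ = kV := IsStronglyCartesian.fac π T.base kQ hb kV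
  have hkl : π.IsHomLift S.base k := IsStronglyCartesian.map_isHomLift π T.base kQ hb kV
  have hkc : π.IsStronglyCartesian S.base k := by
    have : π.IsStronglyCartesian (S.base ≫ T.base) (k ≫ kQ) := by rw [hk, ← hb]; exact hkV
    exact IsStronglyCartesian.of_comp π (g := T.base) (ψ := kQ)
  refine ⟨k, wV ≫ wP, hkc, inferInstance, ?_, ?_, ?_⟩
  · have key : wV ≫ kP = k ≫ wQ := by
      apply IsStronglyCartesian.ext π T.base T.h S.base
      rw [assoc, ← p3, v1, assoc, q1, ← assoc, hk]
    rw [assoc, p1, ← assoc, key, assoc, q2]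
  · rw [v2, p2, assoc]
  · rw [v3, q3, ← assoc, hk]

theorem exists_isComposite [π.IsFibered] (S : VHSpan π X Y) (T : VHSpan π Y Z) :
    ∃ U, IsComposite S T U := by
  have hT : π.obj T.apex = π.obj Y := CategoryTheory.IsHomLift.domain_eq π (𝟙 (π.obj Y)) T.v
  let k := IsPreFibered.pullbackMap hT S.base
  have hk : π.IsStronglyCartesian S.base k := inferInstance
  let w := IsStronglyCartesian.map π S.base S.h (id_comp S.base).symm (k ≫ T.v)
  have hw : w ≫ S.h = k ≫ T.v :=
    IsStronglyCartesian.fac π S.base S.h (id_comp S.base).symm (k ≫ T.v)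
  have hwl : π.IsHomLift (𝟙 (π.obj X)) w :=
    IsStronglyCartesian.map_isHomLift π S.base S.h (id_comp S.base).symm (k ≫ T.v)
  exact ⟨⟨_, S.base ≫ T.base, w ≫ S.v, k ≫ T.h, inferInstance, inferInstance⟩,
    k, w, hk, hwl, hw, rfl, rfl⟩

/-- A chosen composite of vh spans (well defined up to equivalence). -/
noncomputable def comp [π.IsFibered] (S : VHSpan π X Y) (T : VHSpan π Y Z) : VHSpan π X Z :=
  (exists_isComposite S T).choose

theorem isComposite_comp [π.IsFibered] (S : VHSpan π X Y) (T : VHSpan π Y Z) :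
    IsComposite S T (comp S T) :=
  (exists_isComposite S T).choose_spec

end VHSpan

/-- The total category `𝒳^*` of the fibrewise dual of a fibration `π : 𝒳 ⥤ B`:
it has the objects of `𝒳`, and its arrows are the equivalence classes of vh spans. -/
def FibDual (_ : 𝒳 ⥤ B) : Type u₁ := 𝒳

/-- The arrow of `𝒳^*` (comorphism) represented by a vh span. -/
def VHSpan.cls {X Y : 𝒳} (S : VHSpan π X Y) :
    Quotient (VHSpan.setoid (π := π) X Y) := Quotient.mk _ S

noncomputable instance [π.IsFibered] : Category.{max u₁ v₁ v} (FibDual π) where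
  Hom X Y := Quotient (VHSpan.setoid (π := π) X Y)
  id X := Quotient.mk _ (VHSpan.idSpan π X)
  comp {_ _ _} f g := Quotient.map₂ VHSpan.comp
    (fun _ _ e _ _ e' => (VHSpan.isComposite_comp _ _).equivalent
      (VHSpan.isComposite_comp _ _) e e') f g
  id_comp {_ _} f := by
    induction f using Quotient.inductionOn with | _ S
    exact Quotient.sound ((VHSpan.isComposite_comp _ _).equivalent (VHSpan.isComposite_id_left S)
      (VHSpan.Equivalent.refl _) (VHSpan.Equivalent.refl _))
  comp_id {_ _} f := by
    induction f using Quotient.inductionOn with | _ S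
    exact Quotient.sound ((VHSpan.isComposite_comp _ _).equivalent (VHSpan.isComposite_id_right S)
      (VHSpan.Equivalent.refl _) (VHSpan.Equivalent.refl _))
  assoc {_ _ _ _} f g h := by
    induction f using Quotient.inductionOn with | _ S
    induction g using Quotient.inductionOn with | _ T
    induction h using Quotient.inductionOn with | _ U
    exact Quotient.sound ((VHSpan.isComposite_assoc (VHSpan.isComposite_comp _ _)
      (VHSpan.isComposite_comp T U) (VHSpan.isComposite_comp _ _)).equivalent
      (VHSpan.isComposite_comp _ _) (VHSpan.Equivalent.refl _) (VHSpan.Equivalent.refl _))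

theorem VHSpan.cls_comp [π.IsFibered] {X Y Z : 𝒳} {S : VHSpan π X Y} {T : VHSpan π Y Z}
    {U : VHSpan π X Z} (h : VHSpan.IsComposite S T U) :
    CategoryStruct.comp (obj := FibDual π) (X := X) (Y := Y) (Z := Z) (S.cls π) (T.cls π) =
      U.cls π :=
  Quotient.sound ((VHSpan.isComposite_comp _ _).equivalent h
    (VHSpan.Equivalent.refl _) (VHSpan.Equivalent.refl _))

/-- The projection `π^* : 𝒳^* ⥤ B`. -/
noncomputable def FibDual.proj [π.IsFibered] : FibDual π ⥤ B where
  obj X := π.obj X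
  map {_ _} f := Quotient.lift VHSpan.base (fun _ _ e => VHSpan.Equivalent.base_eq e) f
  map_id _ := rfl
  map_comp {_ _ _} f g := by
    induction f using Quotient.inductionOn with | _ S
    induction g using Quotient.inductionOn with | _ T
    exact (VHSpan.isComposite_comp S T).base_eq

variable {π}

/-- The vh span `(1, h)` of a Cartesian arrow `h`. -/
def VHSpan.ofCartesian {A A' : B} (α : A ⟶ A') {X Y : 𝒳} (h : X ⟶ Y)
    (hh : π.IsStronglyCartesian α h) : VHSpan π X Y where
  apex := X
  base := π.map h
  v := 𝟙 X
  h := h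
  vertical := inferInstance
  cartesian := by
    obtain ⟨⟩ := hh.toIsHomLift
    exact hh

theorem VHSpan.factor_ofCartesian {W X Y : 𝒳} (h : X ⟶ Y)
    (hh : π.IsStronglyCartesian (π.map h) h) (S : VHSpan π W Y) (g : π.obj W ⟶ π.obj X)
    (hS : g ≫ π.map h = S.base) :
    ∃ χ : VHSpan π W X, χ.base = g ∧ IsComposite χ (VHSpan.ofCartesian _ h hh) S ∧
      ∀ V : VHSpan π W X, V.base = g → ∀ V', IsComposite V (VHSpan.ofCartesian _ h hh) V' →
        V'.Equivalent S → V.Equivalent χ := by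
  let k := IsStronglyCartesian.map π (π.map h) h hS.symm S.h
  have hk : k ≫ h = S.h := IsStronglyCartesian.fac π (π.map h) h hS.symm S.h
  have hkl : π.IsHomLift g k := IsStronglyCartesian.map_isHomLift π (π.map h) h hS.symm S.h
  have hkc : π.IsStronglyCartesian g k := by
    have : π.IsStronglyCartesian (g ≫ π.map h) (k ≫ h) := by rw [hk, hS]; exact S.cartesian
    exact IsStronglyCartesian.of_comp π (g := π.map h) (ψ := h)
  refine ⟨⟨S.apex, g, S.v, k, S.vertical, hkc⟩, rfl, ⟨k, 𝟙 _, hkc,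
    CategoryTheory.IsHomLift.id (CategoryTheory.IsHomLift.domain_eq π (𝟙 (π.obj W)) S.v),
    by simp [VHSpan.ofCartesian], by simp, hk.symm⟩, ?_⟩
  rintro V rfl V' hc e
  have e' := hc.equivalent (U' := ⟨V.apex, V.base ≫ π.map h, V.v, V.h ≫ h, V.vertical,
      inferInstance⟩) (S' := V) (T' := VHSpan.ofCartesian _ h hh) ⟨V.h, 𝟙 _, V.cartesian,
    CategoryTheory.IsHomLift.id (CategoryTheory.IsHomLift.domain_eq π (𝟙 (π.obj W)) V.v),
    by simp [VHSpan.ofCartesian], by simp, rfl⟩ (.refl _) (.refl _)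
  obtain ⟨s, hs, s1, s2⟩ := e'.symm.trans e
  refine ⟨s, hs, s1, ?_⟩
  have : π.IsHomLift (𝟙 (π.obj W) ≫ V.base) (s.hom ≫ V.h) :=
    CategoryTheory.IsHomLift.comp π (𝟙 (π.obj W)) V.base s.hom V.h
  have : π.IsHomLift V.base (s.hom ≫ V.h) := by rwa [id_comp] at this
  apply IsStronglyCartesian.ext π (π.map h) h V.base
  rw [assoc]
  exact s2.trans hk.symm

/-- A comorphism represented by `(1, h)`, with `h` Cartesian, is Cartesian. -/
theorem isStronglyCartesian_ofCartesian [π.IsFibered] {A A' : B} (α : A ⟶ A') {X Y : 𝒳}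
    (h : X ⟶ Y) (hh : π.IsStronglyCartesian α h) :
    (FibDual.proj π).IsStronglyCartesian (a := X) (b := Y) α
      ((VHSpan.ofCartesian α h hh).cls π) := by
  obtain ⟨⟩ := hh.toIsHomLift
  refine { toIsHomLift := ?_, universal_property' := ?_ }
  · exact CategoryTheory.IsHomLift.map (p := FibDual.proj π) (a := X) (b := Y)
      ((VHSpan.ofCartesian _ h hh).cls π)
  intro a' g φ' hφ'
  obtain ⟨S, rfl⟩ := Quotient.exists_rep φ'
  have hS : g ≫ π.map h = S.base :=
    @CategoryTheory.IsHomLift.eq_of_isHomLift _ _ _ _ _ _ _ _ _ hφ'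
  obtain ⟨χ, hχ, hc, hu⟩ := VHSpan.factor_ofCartesian h hh S g hS
  refine ⟨χ.cls π, ⟨?_, VHSpan.cls_comp π hc⟩, ?_⟩
  · subst hχ
    exact CategoryTheory.IsHomLift.map (p := FibDual.proj π) (a := a') (b := X) (χ.cls π)
  · rintro ψ ⟨hψ, hψc⟩
    induction ψ using Quotient.inductionOn with | _ V
    have hV : g = V.base := @CategoryTheory.IsHomLift.eq_of_isHomLift _ _ _ _ _ _ _ _ _ hψ
    exact Quotient.sound (hu V hV.symm _ (VHSpan.isComposite_comp _ _) (Quotient.exact hψc))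

end FibrewiseDual

/-- The fibrewise dual `𝒳^* → B` of a fibration `𝒳 → B`. -/
noncomputable def dualFibration (𝒳 : BasedCategory.{v₁, u₁} B) [𝒳.p.IsFibered] :
    BasedCategory.{max u₁ v₁ v, u₁} B :=
  BasedCategory.ofFunctor (FibDual.proj 𝒳.p)

/-- The cleavage of `𝒳^*` given by a cleavage of `𝒳`: the Cartesian lift `α^*(Y) ⟶ Y` in `𝒳^*` is
represented by the vh span `(1, h)` with `h` the chosen Cartesian lift in `𝒳`. -/
noncomputable def Cleavage.dual {𝒳 : BasedCategory.{v₁, u₁} B} [𝒳.p.IsFibered]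
    (c : Cleavage 𝒳.p) : Cleavage (dualFibration 𝒳).p where
  obj Y α := c.obj Y α
  map Y α := (VHSpan.ofCartesian α (c.map Y α) (c.cartesian _ α)).cls 𝒳.p
  cartesian Y α := isStronglyCartesian_ofCartesian α (c.map Y α) _

end Fibrations

/-! ### Strength -/

section Strength

variable {B : Type u} [Category.{v} B] [CartesianMonoidalCategory B]

namespace Cleavage

section

variable {𝒳 : Type u₁} [Category.{v₁} 𝒳] {π : 𝒳 ⥤ B} (c : Cleavage π)

/-- `Q ⊗ X := p^*(X)`, for `p : Q × π(X) ⟶ π(X)` the projection. -/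
def tensor (Q : B) (X : 𝒳) : 𝒳 := c.obj X (snd Q (π.obj X))

/-- The Cartesian arrow `Q ⊗ X ⟶ X` over the projection. -/
def tensorProj (Q : B) (X : 𝒳) : c.tensor Q X ⟶ X := c.map X (snd Q (π.obj X))

instance (Q : B) (X : 𝒳) : π.IsStronglyCartesian (snd Q (π.obj X)) (c.tensorProj Q X) :=
  c.cartesian _ _

theorem tensor_base (Q : B) (X : 𝒳) : π.obj (c.tensor Q X) = Q ⊗ π.obj X :=
  CategoryTheory.IsHomLift.domain_eq π (snd Q (π.obj X)) (c.tensorProj Q X)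

/-- `f ⊗ g : Q ⊗ X ⟶ Q' ⊗ X'`, the unique arrow over `f × π(g)` which is compatible with the
Cartesian arrows to `X` and `X'`. -/
noncomputable def tensorHom {Q Q' : B} (f : Q ⟶ Q') {X X' : 𝒳} (g : X ⟶ X') :
    c.tensor Q X ⟶ c.tensor Q' X' :=
  IsStronglyCartesian.map π (snd Q' (π.obj X')) (c.tensorProj Q' X')
    (g := f ⊗ₘ π.map g) (f' := snd Q (π.obj X) ≫ π.map g) (by simp)
    (c.tensorProj Q X ≫ g)

instance {Q Q' : B} (f : Q ⟶ Q') {X X' : 𝒳} (g : X ⟶ X') :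
    π.IsHomLift (f ⊗ₘ π.map g) (c.tensorHom f g) :=
  IsStronglyCartesian.map_isHomLift _ _ _ _ _

/-- The canonical isomorphism `(Q × Q') ⊗ X ⟶ Q ⊗ (Q' ⊗ X)`: the unique arrow over the
associativity isomorphism `(Q × Q') × π(X) ⟶ Q × (Q' × π(X))` which is compatible with the
projections to `Q' ⊗ X`. -/
noncomputable def tensorAssoc (Q Q' : B) (X : 𝒳) :
    c.tensor (Q ⊗ Q') X ⟶ c.tensor Q (c.tensor Q' X) :=
  IsStronglyCartesian.map π (snd Q (π.obj (c.tensor Q' X))) (c.tensorProj Q (c.tensor Q' X))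
    (g := (α_ Q Q' (π.obj X)).hom ≫ Q ◁ eqToHom (c.tensor_base Q' X).symm)
    (f' := (snd Q Q' ⊗ₘ π.map (𝟙 X)) ≫ eqToHom (c.tensor_base Q' X).symm)
    (by
      rw [assoc, whiskerLeft_snd, ← assoc]
      congr 1
      ext <;> simp)
    (c.tensorHom (snd Q Q') (𝟙 X))

end

end Cleavage

variable {𝒳 : BasedCategory.{v₁, u₁} B} {𝒴 : BasedCategory.{v₂, u₂} B}

/-- The canonical vertical comparison `F(Q ⊗ X) ⟶ Q ⊗ F(X)` of a functor `F` over `B`. -/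
noncomputable def comparison (c : Cleavage 𝒳.p) (d : Cleavage 𝒴.p) (F : 𝒳 ⥤ᵇ 𝒴)
    (Q : B) (X : 𝒳.obj) : F.obj (c.tensor Q X) ⟶ d.tensor Q (F.obj X) :=
  IsStronglyCartesian.map 𝒴.p (snd Q (𝒴.p.obj (F.obj X))) (d.tensorProj Q (F.obj X))
    (g := Q ◁ eqToHom (F.w_obj X).symm) (f' := snd Q (𝒳.p.obj X) ≫ eqToHom (F.w_obj X).symm)
    (by simp) (F.map (c.tensorProj Q X))

/-- A (fibrational) strength on a functor `F` over `B`: vertical arrows `Q ⊗ F(X) ⟶ F(Q ⊗ X)`,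
natural in `Q` and `X`, with a unit and an associativity constraint. -/
@[ext]
structure Strength (c : Cleavage 𝒳.p) (d : Cleavage 𝒴.p) (F : 𝒳 ⥤ᵇ 𝒴) where
  app : ∀ (Q : B) (X : 𝒳.obj), d.tensor Q (F.obj X) ⟶ F.obj (c.tensor Q X)
  vertical : ∀ (Q : B) (X : 𝒳.obj), 𝒴.p.IsHomLift (𝟙 (Q ⊗ 𝒳.p.obj X)) (app Q X)
  naturality : ∀ {Q Q' : B} (f : Q ⟶ Q') {X X' : 𝒳.obj} (g : X ⟶ X'),
    d.tensorHom f (F.map g) ≫ app Q' X' = app Q X ≫ F.map (c.tensorHom f g)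
  unit : ∀ X : 𝒳.obj,
    app (𝟙_ B) X ≫ F.map (c.tensorProj (𝟙_ B) X) = d.tensorProj (𝟙_ B) (F.obj X)
  assoc : ∀ (Q Q' : B) (X : 𝒳.obj),
    d.tensorAssoc Q Q' (F.obj X) ≫ d.tensorHom (𝟙 Q) (app Q' X) ≫ app Q (c.tensor Q' X) =
      app (Q ⊗ Q') X ≫ F.map (c.tensorAssoc Q Q' X)

end Strength

/-! ### Vector bundles as module objects over the objects of `B` -/

section VectorBundles

variable {B : Type u} [Category.{v} B]

/-- The generalized elements of `p : E ⟶ A` over `a : T ⟶ A`, "the fibre `E_a`". -/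
@[ext]
structure El {E A : B} (p : E ⟶ A) {T : B} (a : T ⟶ A) where
  val : T ⟶ E
  w : val ≫ p = a

/-- Change of stage: `E_a → E_{f ≫ a}` for `f : S ⟶ T`. -/
def El.restrict {E A : B} {p : E ⟶ A} {S T : B} (f : S ⟶ T) {a : T ⟶ A} (x : El p a) :
    El p (f ≫ a) := ⟨f ≫ x.val, by rw [assoc, x.w]⟩

/-- The action on generalized elements of a commutative square from `p` to `q` over `α`. -/
def El.map {E A E' A' : B} {p : E ⟶ A} {q : E' ⟶ A'} {t : E ⟶ E'} {α : A ⟶ A'}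
    (w : t ≫ q = p ≫ α) {T : B} {a : T ⟶ A} (x : El p a) : El q (a ≫ α) :=
  ⟨x.val ≫ t, by rw [assoc, w, ← assoc, x.w]⟩

variable [CartesianMonoidalCategory B] [BraidedCategory B]

/-- An `R`-vector bundle over `A`, that is, an `R`-module object in `B / A` (for a commutative
ring object `R` of `B`, the ground ring): an arrow `proj : total ⟶ A`, which can be pulled back
along every arrow into `A` (no condition if `B` has pullbacks), and a module structure over the
ring `T ⟶ R` on its generalized elements over each `a : T ⟶ A`, natural in `T`. -/
structure VBOver (R : B) [CommRingObj R] (A : B) where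
  total : B
  proj : total ⟶ A
  hasPullback : ∀ ⦃A' : B⦄ (α : A' ⟶ A), Limits.HasPullback proj α
  addCommGroup : ∀ ⦃T : B⦄ (a : T ⟶ A), AddCommGroup (El proj a)
  module : ∀ ⦃T : B⦄ (a : T ⟶ A), Module (T ⟶ R) (El proj a)
  restrict_add : ∀ ⦃S T : B⦄ (f : S ⟶ T) (a : T ⟶ A) (x y : El proj a),
    (x + y).restrict f = x.restrict f + y.restrict f
  restrict_smul : ∀ ⦃S T : B⦄ (f : S ⟶ T) (a : T ⟶ A) (r : T ⟶ R) (x : El proj a),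
    (r • x).restrict f = (f ≫ r) • x.restrict f

attribute [instance] VBOver.hasPullback VBOver.addCommGroup VBOver.module

variable (R : B) [CommRingObj R]

/-- An `R`-vector bundle over a variable base: the objects of the total category `𝒱`. -/
structure VB where
  base : B
  bundle : VBOver R base

variable {R}

namespace VB

/-- A map of vector bundles: a commutative square which is fibrewise linear. -/
@[ext]
structure Hom (X Y : VB R) where
  base : X.base ⟶ Y.base
  total : X.bundle.total ⟶ Y.bundle.total
  w : total ≫ Y.bundle.proj = X.bundle.proj ≫ base
  map_add : ∀ ⦃T : B⦄ (a : T ⟶ X.base) (x y : El X.bundle.proj a),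
    El.map w (x + y) = El.map w x + El.map w y
  map_smul : ∀ ⦃T : B⦄ (a : T ⟶ X.base) (r : T ⟶ R) (x : El X.bundle.proj a),
    El.map w (r • x) = r • El.map w x

theorem add_val_congr {X : VB R} {T : B} {a b : T ⟶ X.base} (h : a = b) (x y : El X.bundle.proj a)
    (x' y' : El X.bundle.proj b) (hx : x.val = x'.val) (hy : y.val = y'.val) : (x + y).val = (x' + y').val := by
  subst h
  rw [El.ext hx, El.ext hy]

theorem smul_val_congr {X : VB R} {T : B} {a b : T ⟶ X.base} (h : a = b) (r : T ⟶ R) (x : El X.bundle.proj a)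
    (x' : El X.bundle.proj b) (hx : x.val = x'.val) : (r • x).val = (r • x').val := by
  subst h
  rw [El.ext hx]

instance : Category.{v} (VB R) where
  Hom := Hom
  id X :=
    { base := 𝟙 _
      total := 𝟙 _
      w := by simp
      map_add := fun T a x y => El.ext (by
        simp only [El.map, comp_id]
        exact add_val_congr (comp_id a).symm _ _ _ _ (by simp) (by simp))
      map_smul := fun T a r x => El.ext (by
        simp only [El.map, comp_id]
        exact smul_val_congr (comp_id a).symm _ _ _ (by simp)) }
  comp {X Y Z} f g :=
    { base := f.base ≫ g.base
      total := f.total ≫ g.total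
      w := by rw [assoc, g.w, ← assoc, f.w, assoc]
      map_add := fun T a x y => El.ext (by
        have h1 := congrArg El.val (f.map_add a x y)
        have h2 := congrArg El.val (g.map_add _ (El.map f.w x) (El.map f.w y))
        rw [← f.map_add] at h2
        refine Eq.trans ?_ (h2.trans (add_val_congr (assoc _ _ _) _ _ _ _ ?_ ?_)) <;> simp [El.map])
      map_smul := fun T a r x => El.ext (by
        have h2 := congrArg El.val (g.map_smul _ r (El.map f.w x))
        rw [← f.map_smul] at h2
        refine Eq.trans ?_ (h2.trans (smul_val_congr (assoc _ _ _) _ _ _ ?_)) <;> simp [El.map]) }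
  id_comp f := by apply Hom.ext <;> simp
  comp_id f := by apply Hom.ext <;> simp
  assoc f g h := by apply Hom.ext <;> simp

@[ext] theorem hom_ext {X Y : VB R} {f g : X ⟶ Y} (h : f.base = g.base) (h' : f.total = g.total) :
    f = g := Hom.ext h h'

@[simp] theorem comp_base {X Y Z : VB R} (f : X ⟶ Y) (g : Y ⟶ Z) :
    (f ≫ g).base = f.base ≫ g.base := rfl
@[simp] theorem comp_total {X Y Z : VB R} (f : X ⟶ Y) (g : Y ⟶ Z) :
    (f ≫ g).total = f.total ≫ g.total := rfl
@[simp] theorem id_base (X : VB R) : (𝟙 X : X ⟶ X).base = 𝟙 _ := rfl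
@[simp] theorem id_total (X : VB R) : (𝟙 X : X ⟶ X).total = 𝟙 _ := rfl

variable (R) in
/-- The projection of the category of vector bundles to the base category. -/
@[simps] def proj : VB R ⥤ B where
  obj X := X.base
  map f := f.base

/-- Generalized elements of a pullback. -/
noncomputable def pullbackElEquiv (Y : VB R) {A : B} (α : A ⟶ Y.base) {T : B} (a : T ⟶ A) :
    El (Limits.pullback.snd Y.bundle.proj α) a ≃ El Y.bundle.proj (a ≫ α) where
  toFun x := ⟨x.val ≫ Limits.pullback.fst _ _, by
    rw [assoc, Limits.pullback.condition, ← assoc, x.w]⟩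
  invFun y := ⟨Limits.pullback.lift y.val a y.w, Limits.pullback.lift_snd _ _ _⟩
  left_inv x := El.ext (by
    apply Limits.pullback.hom_ext
    · exact Limits.pullback.lift_fst _ _ _
    · exact (Limits.pullback.lift_snd _ _ _).trans x.w.symm)
  right_inv y := El.ext (Limits.pullback.lift_fst _ _ _)

/-- The pullback `α^*(Y)` of a vector bundle, as a vector bundle over the domain of `α`. -/
noncomputable def pullOver (Y : VB R) {A : B} (α : A ⟶ Y.base) : VBOver R A :=
    { total := Limits.pullback Y.bundle.proj α
      proj := Limits.pullback.snd _ _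
      hasPullback := fun _ β =>
        (IsPullback.of_right' (IsPullback.of_hasPullback Y.bundle.proj (β ≫ α))
          (IsPullback.of_hasPullback Y.bundle.proj α)).hasPullback
      addCommGroup := fun _ a => (Y.pullbackElEquiv α a).addCommGroup
      module := fun T a =>
        let _ := (Y.pullbackElEquiv α a).addCommGroup
        (Y.pullbackElEquiv α a).module (T ⟶ R)
      restrict_add := fun S T f a x y => by
        let _ := (Y.pullbackElEquiv α a).addCommGroup
        let _ := (Y.pullbackElEquiv α (f ≫ a)).addCommGroup
        apply (Y.pullbackElEquiv α (f ≫ a)).injective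
        apply El.ext
        have h1 := congrArg El.val ((Y.pullbackElEquiv α a).apply_symm_apply
          (Y.pullbackElEquiv α a x + Y.pullbackElEquiv α a y))
        have h2 := congrArg El.val ((Y.pullbackElEquiv α (f ≫ a)).apply_symm_apply
          (Y.pullbackElEquiv α (f ≫ a) (x.restrict f) +
            Y.pullbackElEquiv α (f ≫ a) (y.restrict f)))
        have h3 := congrArg El.val (Y.bundle.restrict_add f (a ≫ α)
          (Y.pullbackElEquiv α a x) (Y.pullbackElEquiv α a y))
        refine Eq.trans ?_ ((h3.trans (add_val_congr (X := Y) (assoc _ _ _).symm _ _ _ _ ?_ ?_)).trans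
          h2.symm)
        · exact (assoc _ _ _).trans (congrArg (f ≫ ·) h1)
        · exact (assoc _ _ _).symm
        · exact (assoc _ _ _).symm
      restrict_smul := fun S T f a r x => by
        let _ := (Y.pullbackElEquiv α a).addCommGroup
        let _ := (Y.pullbackElEquiv α (f ≫ a)).addCommGroup
        let _ := (Y.pullbackElEquiv α a).module (T ⟶ R)
        let _ := (Y.pullbackElEquiv α (f ≫ a)).module (S ⟶ R)
        apply (Y.pullbackElEquiv α (f ≫ a)).injective
        apply El.ext
        have h1 := congrArg El.val ((Y.pullbackElEquiv α a).apply_symm_apply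
          (r • Y.pullbackElEquiv α a x))
        have h2 := congrArg El.val ((Y.pullbackElEquiv α (f ≫ a)).apply_symm_apply
          ((f ≫ r) • Y.pullbackElEquiv α (f ≫ a) (x.restrict f)))
        have h3 := congrArg El.val (Y.bundle.restrict_smul f (a ≫ α) r
          (Y.pullbackElEquiv α a x))
        refine Eq.trans ?_ ((h3.trans (smul_val_congr (X := Y) (assoc _ _ _).symm _ _ _ ?_)).trans
          h2.symm)
        · exact (assoc _ _ _).trans (congrArg (f ≫ ·) h1)
        · exact (assoc _ _ _).symm }

/-- The pullback `α^*(Y)` of a vector bundle. -/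
noncomputable abbrev pull (Y : VB R) {A : B} (α : A ⟶ Y.base) : VB R := ⟨A, Y.pullOver α⟩

theorem pull_add (Y : VB R) {A : B} (α : A ⟶ Y.base) {T : B} (a : T ⟶ A)
    (x y : El (Y.pull α).bundle.proj a) :
    Y.pullbackElEquiv α a (x + y) = Y.pullbackElEquiv α a x + Y.pullbackElEquiv α a y :=
  (Y.pullbackElEquiv α a).apply_symm_apply _

theorem pull_smul (Y : VB R) {A : B} (α : A ⟶ Y.base) {T : B} (a : T ⟶ A) (r : T ⟶ R)
    (x : El (Y.pull α).bundle.proj a) :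
    Y.pullbackElEquiv α a (r • x) = r • Y.pullbackElEquiv α a x :=
  (Y.pullbackElEquiv α a).apply_symm_apply _

/-- The Cartesian arrow `α^*(Y) ⟶ Y`. -/
noncomputable def pullMap (Y : VB R) {A : B} (α : A ⟶ Y.base) : Y.pull α ⟶ Y where
  base := α
  total := Limits.pullback.fst _ _
  w := Limits.pullback.condition
  map_add _ a x y := Y.pull_add α a x y
  map_smul _ a r x := Y.pull_smul α a r x

/-- The factorization of a map of vector bundles through a pullback. -/
noncomputable def pullLift {X Y : VB R} {A : B} (α : A ⟶ Y.base) (g : X.base ⟶ A)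
    (φ : X ⟶ Y) (h : φ.base = g ≫ α) : X ⟶ Y.pull α where
  base := g
  total := Limits.pullback.lift φ.total (X.bundle.proj ≫ g) (by rw [φ.w, h, assoc])
  w := Limits.pullback.lift_snd _ _ _
  map_add T a x y := by
    apply (Y.pullbackElEquiv α (a ≫ g)).injective
    rw [pull_add]
    apply El.ext
    have h1 := congrArg El.val (φ.map_add a x y)
    refine Eq.trans ?_ (h1.trans (add_val_congr (X := Y) (by rw [h, assoc]) _ _ _ _ ?_ ?_))
    · exact (assoc _ _ _).trans (congrArg (_ ≫ ·) (Limits.pullback.lift_fst _ _ _))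
    · exact ((assoc _ _ _).trans (congrArg (_ ≫ ·) (Limits.pullback.lift_fst _ _ _))).symm
    · exact ((assoc _ _ _).trans (congrArg (_ ≫ ·) (Limits.pullback.lift_fst _ _ _))).symm
  map_smul T a r x := by
    apply (Y.pullbackElEquiv α (a ≫ g)).injective
    rw [pull_smul]
    apply El.ext
    have h1 := congrArg El.val (φ.map_smul a r x)
    refine Eq.trans ?_ (h1.trans (smul_val_congr (X := Y) (by rw [h, assoc]) _ _ _ ?_))
    · exact (assoc _ _ _).trans (congrArg (_ ≫ ·) (Limits.pullback.lift_fst _ _ _))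
    · exact ((assoc _ _ _).trans (congrArg (_ ≫ ·) (Limits.pullback.lift_fst _ _ _))).symm

theorem isStronglyCartesian_pullMap (Y : VB R) {A : B} (α : A ⟶ Y.base) :
    (proj R).IsStronglyCartesian α (Y.pullMap α) where
  toIsHomLift := CategoryTheory.IsHomLift.map (p := proj R) (Y.pullMap α)
  universal_property' {X} g φ hφ := by
    have h : φ.base = g ≫ α := (@CategoryTheory.IsHomLift.eq_of_isHomLift _ _ _ _ _ _ _ _ _ hφ).symm
    refine ⟨pullLift α g φ h, ⟨CategoryTheory.IsHomLift.map (p := proj R) (pullLift α g φ h), ?_⟩,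
      ?_⟩
    · apply hom_ext
      · exact h.symm
      · exact Limits.pullback.lift_fst _ _ _
    · rintro χ ⟨hχ, hc⟩
      have hb : g = χ.base := @CategoryTheory.IsHomLift.eq_of_isHomLift _ _ _ _ _ _ _ _ _ hχ
      apply hom_ext
      · exact hb.symm
      · apply Limits.pullback.hom_ext
        · exact (congrArg Hom.total hc).trans (Limits.pullback.lift_fst _ _ _).symm
        · refine χ.w.trans (Eq.trans ?_ (Limits.pullback.lift_snd _ _ _).symm)
          rw [hb]

/-- Vector bundles form a fibration over `B`. -/
instance : (proj R).IsFibered :=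
  IsFibered.of_exists_isStronglyCartesian fun Y _ α =>
    ⟨Y.pull α, Y.pullMap α, Y.isStronglyCartesian_pullMap α⟩

variable (R) in
/-- The fibration of vector bundles. -/
abbrev fibration : BasedCategory.{v, max u v} B := BasedCategory.ofFunctor (proj R)

instance : (fibration R).p.IsFibered := inferInstanceAs (proj R).IsFibered

end VB

/-! ### Fibrewise linear duals -/

/-- A linear functional on the fibre of `X` over the generalized point `a : T ⟶ A`, that is,
a linear map over `T` from `a^*(X)` to the trivial bundle with fibre `R`. -/
structure Functional {A : B} (X : VBOver R A) {T : B} (a : T ⟶ A) where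
  toLin : ∀ ⦃S : B⦄ (f : S ⟶ T), El X.proj (f ≫ a) →ₗ[(S ⟶ R)] (S ⟶ R)
  natural : ∀ ⦃S' S : B⦄ (g : S' ⟶ S) (f : S ⟶ T) (x : El X.proj (f ≫ a))
    (x' : El X.proj ((g ≫ f) ≫ a)), x'.val = g ≫ x.val → toLin (g ≫ f) x' = g ≫ toLin f x

/-- A fibrewise linear dual of a vector bundle `X` over `A`: a vector bundle `dual` over `A` with
a bilinear pairing with `X`, whose fibre over any generalized point `a` of `A` is, by means of the
pairing, the module of linear functionals on the fibre of `X` over `a`. It is unique up to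
unique isomorphism compatible with the pairings. -/
structure FibrewiseLinearDual {A : B} (X : VBOver R A) where
  dual : VBOver R A
  pair : ∀ ⦃T : B⦄ (a : T ⟶ A), El dual.proj a →ₗ[(T ⟶ R)] El X.proj a →ₗ[(T ⟶ R)] (T ⟶ R)
  pair_restrict : ∀ ⦃S T : B⦄ (f : S ⟶ T) (a : T ⟶ A) (d : El dual.proj a) (x : El X.proj a),
    pair (f ≫ a) (d.restrict f) (x.restrict f) = f ≫ pair a d x
  universal : ∀ ⦃T : B⦄ (a : T ⟶ A) (φ : Functional X a), ∃! d : El dual.proj a,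
    ∀ ⦃S : B⦄ (f : S ⟶ T) (x : El X.proj (f ≫ a)), pair (f ≫ a) (d.restrict f) x = φ.toLin f x

namespace FibrewiseLinearDual

variable {A : B} {X : VBOver R A} (P : FibrewiseLinearDual X)

/-- The pairing on generalized elements over an unspecified point of the base. -/
def ev {T : B} (d : T ⟶ P.dual.total) (x : T ⟶ X.total) (h : x ≫ X.proj = d ≫ P.dual.proj) :
    T ⟶ R :=
  P.pair (d ≫ P.dual.proj) ⟨d, rfl⟩ ⟨x, h⟩

theorem pair_eq_ev {T : B} {a : T ⟶ A} (d : El P.dual.proj a) (x : El X.proj a) :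
    P.pair a d x = P.ev d.val x.val (x.w.trans d.w.symm) := by
  obtain ⟨d, rfl⟩ := d
  rfl

theorem ev_congr {T : B} {d d' : T ⟶ P.dual.total} {x x' : T ⟶ X.total} (hd : d = d') (hx : x = x')
    (h : x ≫ X.proj = d ≫ P.dual.proj) (h' : x' ≫ X.proj = d' ≫ P.dual.proj) :
    P.ev d x h = P.ev d' x' h' := by
  subst hd hx
  rfl

theorem comp_ev {S T : B} (f : S ⟶ T) (d : T ⟶ P.dual.total) (x : T ⟶ X.total)
    (h : x ≫ X.proj = d ≫ P.dual.proj) (h' : (f ≫ x) ≫ X.proj = (f ≫ d) ≫ P.dual.proj) :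
    f ≫ P.ev d x h = P.ev (f ≫ d) (f ≫ x) h' := by
  rw [ev, ← P.pair_restrict, pair_eq_ev]
  rfl

/-- The linear functional given by an element of the dual. -/
def functional {T : B} {a : T ⟶ A} (d : El P.dual.proj a) : Functional X a where
  toLin _ f := P.pair (f ≫ a) (d.restrict f)
  natural S' S g f x x' hx := by
    rw [pair_eq_ev, pair_eq_ev, comp_ev]
    · exact P.ev_congr (assoc _ _ _) hx _ _
    · simp only [assoc, x.w, El.restrict, d.w]

theorem ext_pair {T : B} {a : T ⟶ A} (d d' : El P.dual.proj a)
    (h : ∀ ⦃S : B⦄ (f : S ⟶ T) (x : El X.proj (f ≫ a)),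
      P.pair (f ≫ a) (d.restrict f) x = P.pair (f ≫ a) (d'.restrict f) x) : d = d' :=
  (P.universal a (P.functional d')).unique h (fun _ _ _ => rfl)

end FibrewiseLinearDual

namespace VB

variable (D : ∀ X : VB R, FibrewiseLinearDual X.bundle)

/-- The fibrewise linear dual `X^†` of a vector bundle, on the same base. -/
abbrev dag (X : VB R) : VB R := ⟨X.base, (D X).dual⟩

/-- For `t : X ⟶ Y` over `α`, the functional on `X` over the base point of an element `d` of
`α^*(Y^†)` given by `x ↦ ⟨d, t(x)⟩`. -/
noncomputable def dagFunctional {X Y : VB R} (t : X ⟶ Y) :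
    Functional X.bundle ((pull (dag D Y) t.base).bundle.proj) where
  toLin S f :=
    { toFun := fun x => (D Y).pair ((f ≫ (pull (dag D Y) t.base).bundle.proj) ≫ t.base)
        ⟨f ≫ (pullMap (dag D Y) t.base).total, by
          rw [assoc, assoc]
          exact congrArg (f ≫ ·) (pullMap (dag D Y) t.base).w⟩ (El.map t.w x)
      map_add' := fun x y => by rw [t.map_add, _root_.map_add]
      map_smul' := fun r x => by rw [t.map_smul, _root_.map_smul]; rfl }
  natural S' S g f x x' hx := by
    dsimp only [LinearMap.coe_mk, AddHom.coe_mk]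
    rw [FibrewiseLinearDual.pair_eq_ev, FibrewiseLinearDual.pair_eq_ev,
      FibrewiseLinearDual.comp_ev]
    · refine FibrewiseLinearDual.ev_congr _ (assoc _ _ _) ?_ _ _
      simp [El.map, hx]
    · simp only [El.map, assoc, t.w]
      rw [reassoc_of% x.w]
      exact congrArg (g ≫ f ≫ ·) (pullMap (dag D Y) t.base).w.symm

/-- The total arrow of the fibrewise transpose `α^*(Y^†) ⟶ X^†` of `t : X ⟶ Y` over `α`. -/
noncomputable def dagVTotal {X Y : VB R} (t : X ⟶ Y) :
    El (D X).dual.proj ((pull (dag D Y) t.base).bundle.proj) :=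
  ((D X).universal _ (dagFunctional D t)).choose

theorem ev_dagVTotal {X Y : VB R} (t : X ⟶ Y) {T : B}
    (z : T ⟶ (pull (dag D Y) t.base).bundle.total) (x : T ⟶ X.bundle.total)
    (h : x ≫ X.bundle.proj = (z ≫ (dagVTotal D t).val) ≫ (D X).dual.proj)
    (h' : (x ≫ t.total) ≫ Y.bundle.proj =
      (z ≫ (pullMap (dag D Y) t.base).total) ≫ (D Y).dual.proj) :
    (D X).ev (z ≫ (dagVTotal D t).val) x h =
      (D Y).ev (z ≫ (pullMap (dag D Y) t.base).total) (x ≫ t.total) h' := by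
  have hx : x ≫ X.bundle.proj = z ≫ (pull (dag D Y) t.base).bundle.proj := by
    rw [h, assoc, (dagVTotal D t).w]
  have := ((D X).universal _ (dagFunctional D t)).choose_spec.1 z ⟨x, hx⟩
  rw [FibrewiseLinearDual.pair_eq_ev] at this
  refine Eq.trans ?_ (this.trans ?_)
  · rfl
  · dsimp only [dagFunctional, LinearMap.coe_mk, AddHom.coe_mk]
    rw [FibrewiseLinearDual.pair_eq_ev]
    rfl

/-- The condition for elements to be paired is inherited by their images. -/
theorem dag_compat {X Y : VB R} (t : X ⟶ Y) {T : B} {a : T ⟶ X.base}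
    (z : El (pull (dag D Y) t.base).bundle.proj a) (x : T ⟶ X.bundle.total)
    (h : x ≫ X.bundle.proj = a) : (x ≫ t.total) ≫ Y.bundle.proj =
      (z.val ≫ (pullMap (dag D Y) t.base).total) ≫ (D Y).dual.proj := by
  rw [assoc, t.w, ← assoc, h.trans z.w.symm, assoc, assoc]
  exact congrArg (z.val ≫ ·) (pullMap (dag D Y) t.base).w.symm

theorem pair_dagVTotal {X Y : VB R} (t : X ⟶ Y) {T : B} {a : T ⟶ X.base}
    (z : El (pull (dag D Y) t.base).bundle.proj a) {b : T ⟶ X.base} (hb : b = a)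
    (d : El (D X).dual.proj b) (hd : d.val = z.val ≫ (dagVTotal D t).val)
    (x : El X.bundle.proj b) (y : El Y.bundle.proj (a ≫ t.base)) (hy : y.val = x.val ≫ t.total) :
    (D X).pair b d x =
      (D Y).pair (a ≫ t.base) (pullbackElEquiv (dag D Y) t.base a z) y := by
  subst hb
  obtain ⟨d, hdw⟩ := d
  obtain ⟨y, hyw⟩ := y
  dsimp only at hd hy
  subst hd hy
  rw [FibrewiseLinearDual.pair_eq_ev, FibrewiseLinearDual.pair_eq_ev]
  exact ev_dagVTotal D t z.val x.val _ (dag_compat D t z x.val x.w)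

/-- The fibrewise transpose `α^*(Y^†) ⟶ X^†` of `t : X ⟶ Y` over `α`. -/
noncomputable def dagV {X Y : VB R} (t : X ⟶ Y) : pull (dag D Y) t.base ⟶ dag D X where
  base := 𝟙 X.base
  total := (dagVTotal D t).val
  w := (dagVTotal D t).w.trans (comp_id _).symm
  map_add T a z z' := by
    apply (D X).ext_pair
    intro S f x
    have hb : f ≫ a ≫ 𝟙 X.base = f ≫ a := by rw [comp_id]
    let y : El Y.bundle.proj ((f ≫ a) ≫ t.base) :=
      ⟨x.val ≫ t.total, by rw [assoc, t.w, ← assoc, x.w, hb]⟩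
    have e := (pull (dag D Y) t.base).bundle.restrict_add f a z z'
    rw [VBOver.restrict_add, _root_.map_add, LinearMap.add_apply,
      pair_dagVTotal D t ((z + z').restrict f) hb _ (by exact (assoc _ _ _).symm) x y rfl,
      pair_dagVTotal D t (z.restrict f) hb _ (by exact (assoc _ _ _).symm) x y rfl,
      pair_dagVTotal D t (z'.restrict f) hb _ (by exact (assoc _ _ _).symm) x y rfl, e,
      pull_add, _root_.map_add, LinearMap.add_apply]
  map_smul T a r z := by
    apply (D X).ext_pair
    intro S f x
    have hb : f ≫ a ≫ 𝟙 X.base = f ≫ a := by rw [comp_id]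
    let y : El Y.bundle.proj ((f ≫ a) ≫ t.base) :=
      ⟨x.val ≫ t.total, by rw [assoc, t.w, ← assoc, x.w, hb]⟩
    have e := (pull (dag D Y) t.base).bundle.restrict_smul f a r z
    rw [VBOver.restrict_smul, _root_.map_smul, LinearMap.smul_apply,
      pair_dagVTotal D t ((r • z).restrict f) hb _ (by exact (assoc _ _ _).symm) x y rfl,
      pair_dagVTotal D t (z.restrict f) hb _ (by exact (assoc _ _ _).symm) x y rfl, e,
      pull_smul, _root_.map_smul, LinearMap.smul_apply]

/-- The comorphism from `X^†` to `Y^†` given by `t : X ⟶ Y` over `α`, as a vh span: its vertical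
part is the fibrewise transpose `α^*(Y^†) ⟶ X^†` of `t`, its Cartesian part is the
Cartesian arrow `α^*(Y^†) ⟶ Y^†`. -/
noncomputable def dagSpan {X Y : VB R} (t : X ⟶ Y) : VHSpan (proj R) (dag D X) (dag D Y) where
  apex := pull (dag D Y) t.base
  base := t.base
  v := dagV D t
  h := pullMap (dag D Y) t.base
  vertical := CategoryTheory.IsHomLift.map (p := proj R) (dagV D t)
  cartesian := isStronglyCartesian_pullMap _ _

/-- The property characterizing the vh spans which are equivalent to `dagSpan D t`. -/
def Transposes {X Y : VB R} (S : VHSpan (proj R) (dag D X) (dag D Y)) (t : X ⟶ Y) : Prop :=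
  S.base = t.base ∧ ∀ ⦃T : B⦄ (z : T ⟶ S.apex.bundle.total) (x : T ⟶ X.bundle.total)
    (h : x ≫ X.bundle.proj = (z ≫ S.v.total) ≫ (D X).dual.proj)
    (h' : (x ≫ t.total) ≫ Y.bundle.proj = (z ≫ S.h.total) ≫ (D Y).dual.proj),
    (D X).ev (z ≫ S.v.total) x h = (D Y).ev (z ≫ S.h.total) (x ≫ t.total) h'

theorem transposes_dagSpan {X Y : VB R} (t : X ⟶ Y) : Transposes D (dagSpan D t) t :=
  ⟨rfl, fun _ z x h h' => ev_dagVTotal D t z x h h'⟩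

theorem span_base {X Y : VB R} (S : VHSpan (proj R) X Y) : S.h.base = S.v.base ≫ S.base := by
  have h1 := CategoryTheory.IsHomLift.fac' (proj R) (𝟙 ((proj R).obj X)) S.v
  have h2 := CategoryTheory.IsHomLift.fac' (proj R) S.base S.h
  simp only [proj_map] at h1 h2
  rw [h1, h2]
  simp
  rfl

theorem span_compat {X Y : VB R} {S : VHSpan (proj R) (dag D X) (dag D Y)} {t : X ⟶ Y}
    (hb : S.base = t.base) {T : B} (z : T ⟶ S.apex.bundle.total) (x : T ⟶ X.bundle.total)
    (h : x ≫ X.bundle.proj = (z ≫ S.v.total) ≫ (D X).dual.proj) :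
    (x ≫ t.total) ≫ Y.bundle.proj = (z ≫ S.h.total) ≫ (D Y).dual.proj := by
  have hv := S.v.w
  have hh := S.h.w
  have hs := span_base S
  dsimp only at hv hh hs
  rw [assoc, t.w, ← assoc, h, assoc, assoc, assoc, hh, hs, hb, reassoc_of% hv]
  rfl

theorem Transposes.equivalent {X Y : VB R} {S S' : VHSpan (proj R) (dag D X) (dag D Y)} {t : X ⟶ Y}
    (hS : Transposes D S t) (hS' : Transposes D S' t) : S.Equivalent S' := by
  have c := S.cartesian
  have c' := S'.cartesian
  rw [hS.1, ← hS'.1] at c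
  let e := IsCartesian.domainUniqueUpToIso (proj R) S'.base S.h S'.h
  have he : e.hom ≫ S.h = S'.h := by simp [e]
  have hev : (proj R).IsHomLift (𝟙 ((proj R).obj (dag D X))) e.hom := inferInstance
  refine ⟨e, hev, ?_, he⟩
  have hb : (e.hom ≫ S.v).base = S'.v.base := by
    have h1 := CategoryTheory.IsHomLift.fac' (proj R) (𝟙 ((proj R).obj (dag D X))) (e.hom ≫ S.v)
    have h2 := CategoryTheory.IsHomLift.fac' (proj R) (𝟙 ((proj R).obj (dag D X))) S'.v
    exact h1.trans h2.symm
  apply hom_ext hb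
  have hp : (e.hom ≫ S.v).total ≫ (D X).dual.proj = S'.v.total ≫ (D X).dual.proj :=
    (e.hom ≫ S.v).w.trans ((congrArg (_ ≫ ·) hb).trans S'.v.w.symm)
  refine congrArg El.val ((D X).ext_pair (a := S'.v.total ≫ (D X).dual.proj)
    ⟨(e.hom ≫ S.v).total, hp⟩ ⟨S'.v.total, rfl⟩ ?_)
  intro T f x
  rw [FibrewiseLinearDual.pair_eq_ev, FibrewiseLinearDual.pair_eq_ev]
  have hx : x.val ≫ X.bundle.proj = (f ≫ S'.v.total) ≫ (D X).dual.proj := by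
    rw [x.w, assoc]
  have hx2 : x.val ≫ X.bundle.proj = ((f ≫ e.hom.total) ≫ S.v.total) ≫ (D X).dual.proj := by
    rw [x.w, ← hp]
    simp
  have k1 := hS.2 (f ≫ e.hom.total) x.val hx2 (span_compat D hS.1 _ _ hx2)
  have k2 := hS'.2 f x.val hx (span_compat D hS'.1 _ _ hx)
  refine Eq.trans ?_ (k1.trans (Eq.trans ?_ k2.symm))
  · exact FibrewiseLinearDual.ev_congr _ (assoc _ _ _).symm rfl _ _
  · refine FibrewiseLinearDual.ev_congr _ ?_ rfl _ _
    rw [assoc, ← he]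
    rfl

theorem transposes_id (X : VB R) : Transposes D (VHSpan.idSpan (proj R) (dag D X)) (𝟙 X) :=
  ⟨rfl, fun _ _ _ _ _ => FibrewiseLinearDual.ev_congr _ rfl (comp_id _).symm _ _⟩

theorem Transposes.comp {X Y Z : VB R} {S : VHSpan (proj R) (dag D X) (dag D Y)}
    {S' : VHSpan (proj R) (dag D Y) (dag D Z)} {U : VHSpan (proj R) (dag D X) (dag D Z)}
    {t : X ⟶ Y} {t' : Y ⟶ Z} (hS : Transposes D S t) (hS' : Transposes D S' t')
    (hU : VHSpan.IsComposite S S' U) : Transposes D U (t ≫ t') := by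
  have hb := hU.base_eq
  obtain ⟨k, w, -, -, e1, e2, e3⟩ := hU
  refine ⟨by rw [hb, hS.1, hS'.1]; rfl, ?_⟩
  intro T z x h h'
  have e1' : w.total ≫ S.h.total = k.total ≫ S'.v.total := congrArg Hom.total e1
  have e2' : U.v.total = w.total ≫ S.v.total := congrArg Hom.total e2
  have e3' : U.h.total = k.total ≫ S'.h.total := congrArg Hom.total e3
  have h1 : x ≫ X.bundle.proj = ((z ≫ w.total) ≫ S.v.total) ≫ (D X).dual.proj := by
    rw [h, e2', ← assoc z]
  have h2 := span_compat D hS.1 _ _ h1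
  have h3 : (x ≫ t.total) ≫ Y.bundle.proj =
      ((z ≫ k.total) ≫ S'.v.total) ≫ (D Y).dual.proj := by
    rw [h2, assoc z, e1', ← assoc z]
  have h4 := span_compat D hS'.1 _ _ h3
  refine Eq.trans ?_ ((hS.2 _ _ h1 h2).trans (Eq.trans ?_ ((hS'.2 _ _ h3 h4).trans ?_)))
  · exact FibrewiseLinearDual.ev_congr _ (by rw [e2', assoc]) rfl _ _
  · exact FibrewiseLinearDual.ev_congr _ (by rw [assoc, e1', assoc]) rfl _ _
  · exact FibrewiseLinearDual.ev_congr _ (by rw [e3', assoc]) (assoc _ _ _) _ _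

/-- The fibrewise linear dualization functor `† : 𝒱 ⥤ 𝒱^*` over `B`. -/
noncomputable def dagger : fibration R ⥤ᵇ dualFibration (fibration R) where
  toFunctor :=
    { obj := fun X => dag D X
      map := fun {_ _} t => (dagSpan D t).cls (proj R)
      map_id := fun X => Quotient.sound ((transposes_dagSpan D (𝟙 X)).equivalent D
        (transposes_id D X))
      map_comp := fun {_ _ _} t t' => Quotient.sound
        ((transposes_dagSpan D (t ≫ t')).equivalent D
          ((transposes_dagSpan D t).comp D (transposes_dagSpan D t')
            (VHSpan.isComposite_comp _ _))) }
  w := rfl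

end VB

end VectorBundles

end StarBundle

open CategoryTheory MonoidalCategory StarBundle

/-! Everything rests on the first claim; the rest is formal. A Cartesian map `t : X ⟶ Y` over `α` is
a pullback square, so the fibre of `X` at a generalized point `a` is, linearly, the fibre of `Y` at
`a ≫ α`. The two fibres have the same functionals. Hence an element of `X^†` can be pushed forward
to `Y^†`, and this yields an inverse of the fibrewise transpose `α^*(Y^†) ⟶ X^†` (`isIso_dagV`). A
span whose vertical leg is invertible is equivalent to some `(1, h)` with `h` Cartesian, so its
class is Cartesian in the dual fibration (`VHSpan.isStronglyCartesian_cls`). For any Cartesian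
functor, the comparison map is the vertical factor between two Cartesian arrows over the same
projection, hence invertible. Its inverse commutes with the projections to `F(X)`. Each strength
axiom equates two arrows over the same base arrow whose codomain is the domain of a Cartesian arrow,
so it can be tested after composition with that arrow (`Strength.ofCartesianFunctor`). Finally,
strengths on composable functors compose (`Strength.comp`). Applied to `F` and dualization this
gives the star bundle strength, and `F` itself need not be Cartesian. -/

namespace StarBundle

open CategoryTheory Category Functor MonoidalCategory CartesianMonoidalCategory
open scoped CommRingObj

/-! ### Strengths of Cartesian functors and of composites -/

section GeneralStrength

universe v₃ u₃

variable {B : Type u} [Category.{v} B] [CartesianMonoidalCategory B]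

/-! ### The calculus of `Q ⊗ X` in a category with a cleavage. -/

namespace Cleavage

variable {𝒳 : Type u₁} [Category.{v₁} 𝒳] {π : 𝒳 ⥤ B} (c : Cleavage π)

theorem isStronglyCartesian_tensorProj (Q : B) (X : 𝒳) {A : B} (hX : π.obj X = A) :
    π.IsStronglyCartesian (snd Q A) (c.tensorProj Q X) := by
  subst hX
  infer_instance

/-- For a functor `F` over `B`, the base of `F(X)` is only propositionally the base of `X`. Allowing
an arbitrary `α` under `g` lets `F.map g` be treated as lying over the arrow under `g`, with no
transport. -/
theorem isHomLift_tensorHom {Q Q' : B} (f : Q ⟶ Q') {X X' : 𝒳} (g : X ⟶ X') {A A' : B}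
    (α : A ⟶ A') [hg : π.IsHomLift α g] : π.IsHomLift (f ⊗ₘ α) (c.tensorHom f g) := by
  obtain ⟨⟩ := hg
  infer_instance

theorem tensorHom_tensorProj {Q Q' : B} (f : Q ⟶ Q') {X X' : 𝒳} (g : X ⟶ X') :
    c.tensorHom f g ≫ c.tensorProj Q' X' = c.tensorProj Q X ≫ g :=
  IsStronglyCartesian.fac _ _ _ _ _

/-- Both sides lie over the same base arrow and agree after the Cartesian projection to `X''`.
Needed for the associativity axiom of a composite strength, where the inner arrow is itself a
composite. -/
theorem tensorHom_comp {Q Q' Q'' : B} (f : Q ⟶ Q') (f' : Q' ⟶ Q'') {X X' X'' : 𝒳}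
    (g : X ⟶ X') (g' : X' ⟶ X'') :
    c.tensorHom (f ≫ f') (g ≫ g') = c.tensorHom f g ≫ c.tensorHom f' g' := by
  have h : π.IsHomLift ((f ≫ f') ⊗ₘ π.map (g ≫ g')) (c.tensorHom f g ≫ c.tensorHom f' g') := by
    rw [π.map_comp, ← tensorHom_comp_tensorHom]
    infer_instance
  apply IsStronglyCartesian.ext π (snd Q'' (π.obj X'')) (c.tensorProj Q'' X'')
    ((f ≫ f') ⊗ₘ π.map (g ≫ g'))
  simp only [assoc, tensorHom_tensorProj]
  rw [reassoc_of% c.tensorHom_tensorProj f g]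

theorem tensorAssoc_tensorProj (Q Q' : B) (X : 𝒳) :
    c.tensorAssoc Q Q' X ≫ c.tensorProj Q (c.tensor Q' X) = c.tensorHom (snd Q Q') (𝟙 X) :=
  haveI : π.IsHomLift ((snd Q Q' ⊗ₘ π.map (𝟙 X)) ≫ eqToHom (c.tensor_base Q' X).symm)
    (c.tensorHom (snd Q Q') (𝟙 X)) := inferInstance
  IsStronglyCartesian.fac _ _ _ _ _

/-- The arrow is constructed over the associator followed by an `eqToHom`. Such an identification
does not affect what an arrow lies over, so it can be dropped. -/
theorem isHomLift_tensorAssoc (Q Q' : B) (X : 𝒳) {A : B} (hX : π.obj X = A) :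
    π.IsHomLift (α_ Q Q' A).hom (c.tensorAssoc Q Q' X) := by
  subst hX
  have h : π.IsHomLift ((α_ Q Q' (π.obj X)).hom ≫ Q ◁ eqToHom (c.tensor_base Q' X).symm)
      (c.tensorAssoc Q Q' X) := IsStronglyCartesian.map_isHomLift _ _ _ _ _
  rwa [MonoidalCategory.whiskerLeft_eqToHom, CategoryTheory.IsHomLift.lift_comp_eqToHom_iff] at h

end Cleavage

/-! ### Comparison maps and the strength of a Cartesian functor. -/

variable {𝒳 : BasedCategory.{v₁, u₁} B} {𝒴 : BasedCategory.{v₂, u₂} B}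
  {𝒵 : BasedCategory.{v₃, u₃} B}

theorem comparison_tensorProj (c : Cleavage 𝒳.p) (d : Cleavage 𝒴.p) (F : 𝒳 ⥤ᵇ 𝒴) (Q : B)
    (X : 𝒳.obj) :
    comparison c d F Q X ≫ d.tensorProj Q (F.obj X) = F.map (c.tensorProj Q X) :=
  IsStronglyCartesian.fac _ _ _ _ _

theorem isHomLift_comparison (c : Cleavage 𝒳.p) (d : Cleavage 𝒴.p) (F : 𝒳 ⥤ᵇ 𝒴) (Q : B)
    (X : 𝒳.obj) : 𝒴.p.IsHomLift (𝟙 (Q ⊗ 𝒳.p.obj X)) (comparison c d F Q X) := by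
  have h : 𝒴.p.IsHomLift (Q ◁ eqToHom (F.w_obj X).symm) (comparison c d F Q X) :=
    IsStronglyCartesian.map_isHomLift _ _ _ _ _
  rwa [MonoidalCategory.whiskerLeft_eqToHom, ← id_comp (eqToHom _),
    CategoryTheory.IsHomLift.lift_comp_eqToHom_iff] at h

/-- The comparison maps of a Cartesian functor are invertible. -/
theorem isIso_comparison (c : Cleavage 𝒳.p) (d : Cleavage 𝒴.p) (F : 𝒳 ⥤ᵇ 𝒴)
    (hF : IsCartesianFunctor F) (Q : B) (X : 𝒳.obj) : IsIso (comparison c d F Q X) := by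
  have h1 := isHomLift_comparison c d F Q X
  have h2 := d.isStronglyCartesian_tensorProj Q (F.obj X) (F.w_obj X)
  -- The composite is the image of a Cartesian arrow, hence Cartesian. Cancelling the Cartesian
  -- projection makes the comparison Cartesian, and a Cartesian arrow over an identity is
  -- invertible.
  have h3 : 𝒴.p.IsStronglyCartesian (𝟙 (Q ⊗ 𝒳.p.obj X) ≫ snd Q (𝒳.p.obj X))
      (comparison c d F Q X ≫ d.tensorProj Q (F.obj X)) := by
    rw [comparison_tensorProj, id_comp]
    exact hF _ _ (c.cartesian _ _)
  have := IsStronglyCartesian.of_comp 𝒴.p (f := 𝟙 (Q ⊗ 𝒳.p.obj X))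
    (φ := comparison c d F Q X) (g := snd Q (𝒳.p.obj X)) (ψ := d.tensorProj Q (F.obj X))
  exact IsStronglyCartesian.isIso_of_base_isIso 𝒴.p (𝟙 (Q ⊗ 𝒳.p.obj X)) _

/-- Vertical arrows which are compatible with the Cartesian arrows to `F(X)` form a strength. -/
def Strength.ofCartesianFunctor (c : Cleavage 𝒳.p) (d : Cleavage 𝒴.p) (F : 𝒳 ⥤ᵇ 𝒴)
    (hF : IsCartesianFunctor F)
    (app : ∀ (Q : B) (X : 𝒳.obj), d.tensor Q (F.obj X) ⟶ F.obj (c.tensor Q X))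
    (vertical : ∀ (Q : B) (X : 𝒳.obj), 𝒴.p.IsHomLift (𝟙 (Q ⊗ 𝒳.p.obj X)) (app Q X))
    (fac : ∀ (Q : B) (X : 𝒳.obj), app Q X ≫ F.map (c.tensorProj Q X) = d.tensorProj Q (F.obj X)) :
    Strength c d F :=
  -- Established ahead of the structure because the associativity axiom uses it.
  have naturality : ∀ {Q Q' : B} (f : Q ⟶ Q') {X X' : 𝒳.obj} (g : X ⟶ X'),
      d.tensorHom f (F.map g) ≫ app Q' X' = app Q X ≫ F.map (c.tensorHom f g) := by
    intro Q Q' f X X' g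
    have h1 := vertical Q X
    have h2 := vertical Q' X'
    have h3 := d.isHomLift_tensorHom f (F.map g) (𝒳.p.map g)
    have h4 : 𝒴.p.IsStronglyCartesian (snd Q' (𝒳.p.obj X')) (F.map (c.tensorProj Q' X')) :=
      hF _ _ (c.cartesian X' (snd Q' (𝒳.p.obj X')))
    have h5 : 𝒴.p.IsHomLift (f ⊗ₘ 𝒳.p.map g) (F.map (c.tensorHom f g)) := inferInstance
    refine IsStronglyCartesian.ext 𝒴.p (snd Q' (𝒳.p.obj X')) (F.map (c.tensorProj Q' X'))
      (f ⊗ₘ 𝒳.p.map g) ?_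
    rw [Category.assoc, Category.assoc, fac, ← F.map_comp, c.tensorHom_tensorProj, F.map_comp,
      d.tensorHom_tensorProj, reassoc_of% fac]
  { app
    vertical
    naturality
    unit := fun X => fac (𝟙_ B) X
    assoc := fun Q Q' X => by
      have h1 := vertical (Q ⊗ Q') X
      have h2 := vertical Q' X
      have h3 := vertical Q (c.tensor Q' X)
      rw [c.tensor_base] at h3
      have h4 := hF _ _ (c.isStronglyCartesian_tensorProj Q _ (c.tensor_base Q' X))
      have h5 := d.isHomLift_tensorAssoc Q Q' (F.obj X) (F.w_obj X)
      have h6 := d.isHomLift_tensorHom (𝟙 Q) (app Q' X) (𝟙 (Q' ⊗ 𝒳.p.obj X))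
      rw [id_tensorHom_id] at h6
      have h7 := c.isHomLift_tensorAssoc Q Q' X rfl
      have h8 : 𝒴.p.IsHomLift (α_ Q Q' (𝒳.p.obj X)).hom (F.map (c.tensorAssoc Q Q' X)) :=
        inferInstance
      refine IsStronglyCartesian.ext 𝒴.p (snd Q (Q' ⊗ 𝒳.p.obj X))
        (F.map (c.tensorProj Q (c.tensor Q' X))) (α_ Q Q' (𝒳.p.obj X)).hom ?_
      -- After the projection to `F(Q' ⊗ X)` the associators become `snd Q Q'` tensored with an
      -- identity, and what remains is naturality of `app` in that arrow.
      rw [Category.assoc, Category.assoc, Category.assoc, fac, d.tensorHom_tensorProj,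
        reassoc_of% d.tensorAssoc_tensorProj Q Q' (F.obj X), ← F.map_comp,
        c.tensorAssoc_tensorProj, ← naturality, F.map_id] }

/-- A Cartesian functor has a strength, which is inverse to its comparison maps. -/
theorem exists_strength_inverse_comparison (c : Cleavage 𝒳.p) (d : Cleavage 𝒴.p) (F : 𝒳 ⥤ᵇ 𝒴)
    (hF : IsCartesianFunctor F) : ∃ s : Strength c d F, ∀ (Q : B) (X : 𝒳.obj),
      comparison c d F Q X ≫ s.app Q X = 𝟙 _ ∧ s.app Q X ≫ comparison c d F Q X = 𝟙 _ := by
  have hi := isIso_comparison c d F hF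
  refine ⟨.ofCartesianFunctor c d F hF (fun Q X => inv (comparison c d F Q X)) ?_ ?_,
    fun Q X => ⟨IsIso.hom_inv_id _, IsIso.inv_hom_id _⟩⟩
  · intro Q X
    have := isHomLift_comparison c d F Q X
    infer_instance
  · intro Q X
    rw [IsIso.inv_comp_eq, comparison_tensorProj]

/-! ### Composition of strengths. -/

/-- The composite of strengths on composable functors over `B`. -/
def Strength.comp {b : Cleavage 𝒳.p} {c : Cleavage 𝒴.p} {d : Cleavage 𝒵.p} {F : 𝒳 ⥤ᵇ 𝒴}
    {G : 𝒴 ⥤ᵇ 𝒵} (t : Strength b c F) (s : Strength c d G) :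
    Strength b d (BasedFunctor.comp F G) where
  app Q X := s.app Q (F.obj X) ≫ G.map (t.app Q X)
  vertical Q X := by
    have h1 : 𝒵.p.IsHomLift (𝟙 (Q ⊗ 𝒳.p.obj X)) (s.app Q (F.obj X)) :=
      F.w_obj X ▸ s.vertical Q (F.obj X)
    have h2 := t.vertical Q X
    have h3 : 𝒵.p.IsHomLift (𝟙 (Q ⊗ 𝒳.p.obj X)) (G.map (t.app Q X)) := inferInstance
    exact CategoryTheory.IsHomLift.comp_of_lift_id (p := 𝒵.p) _ (s.app Q (F.obj X))
      (G.map (t.app Q X))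
  -- Here and in the next two fields, `h` is the goal with the composite functor unfolded
  -- definitionally, so that the axioms of `s` and `t` can be rewritten with.
  naturality {Q Q'} f {X X'} g := by
    have h : d.tensorHom f (G.map (F.map g)) ≫ s.app Q' (F.obj X') ≫ G.map (t.app Q' X') =
        (s.app Q (F.obj X) ≫ G.map (t.app Q X)) ≫ G.map (F.map (b.tensorHom f g)) := by
      rw [reassoc_of% s.naturality f (F.map g), Category.assoc, ← G.map_comp, t.naturality f g,
        G.map_comp]
    exact h
  unit X := by
    have h : (s.app (𝟙_ B) (F.obj X) ≫ G.map (t.app (𝟙_ B) X)) ≫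
        G.map (F.map (b.tensorProj (𝟙_ B) X)) = d.tensorProj (𝟙_ B) (G.obj (F.obj X)) := by
      rw [Category.assoc, ← G.map_comp, t.unit, s.unit]
    exact h
  assoc Q Q' X := by
    have h1 := s.assoc Q Q' (F.obj X)
    have h2 := d.tensorHom_comp (𝟙 Q) (𝟙 Q) (s.app Q' (F.obj X)) (G.map (t.app Q' X))
    rw [comp_id] at h2
    have h : d.tensorAssoc Q Q' (G.obj (F.obj X)) ≫
        d.tensorHom (𝟙 Q) (s.app Q' (F.obj X) ≫ G.map (t.app Q' X)) ≫
          s.app Q (F.obj (b.tensor Q' X)) ≫ G.map (t.app Q (b.tensor Q' X)) =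
        (s.app (Q ⊗ Q') (F.obj X) ≫ G.map (t.app (Q ⊗ Q') X)) ≫
          G.map (F.map (b.tensorAssoc Q Q' X)) := by
      -- Naturality of `s` moves `G.map (t.app Q' X)` to the right of both components of `s`. The
      -- axiom of `s` then applies on the left, and that of `t`, under `G`, on the right.
      rw [h2, Category.assoc, reassoc_of% s.naturality (𝟙 Q) (t.app Q' X), reassoc_of% h1,
        Category.assoc, ← G.map_comp, ← G.map_comp, ← G.map_comp, t.assoc]
    exact h

end GeneralStrength

/-! ### The dualization functor is Cartesian -/

section DaggerCartesian

variable {B : Type u} [Category.{v} B]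

/-! ### Cartesian arrows of the fibrewise dual. -/

/-- A comorphism represented by a vh span with invertible vertical leg is Cartesian. -/
theorem VHSpan.isStronglyCartesian_cls {𝒳 : Type u₁} [Category.{v₁} 𝒳] {π : 𝒳 ⥤ B}
    [π.IsFibered] {X Y : 𝒳} (S : VHSpan π X Y) [IsIso S.v] :
    (FibDual.proj π).IsStronglyCartesian (a := X) (b := Y) S.base (S.cls π) := by
  have h : π.IsStronglyCartesian S.base (inv S.v ≫ S.h) := by
    have h1 : π.IsHomLift (𝟙 (π.obj X)) (inv S.v) := inferInstance
    have h2 : π.IsStronglyCartesian (𝟙 (π.obj X)) (inv S.v) := inferInstance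
    have h3 : π.IsStronglyCartesian (𝟙 (π.obj X) ≫ S.base) (inv S.v ≫ S.h) :=
      IsStronglyCartesian.comp π
    rwa [id_comp] at h3
  -- The left leg itself serves as the vertical isomorphism of apices between `(1, v⁻¹ ≫ h)` and
  -- `(v, h)`.
  have e : (VHSpan.ofCartesian S.base (inv S.v ≫ S.h) h).Equivalent S :=
    ⟨(asIso S.v : S.apex ≅ X), S.vertical, comp_id _, IsIso.hom_inv_id_assoc S.v S.h⟩
  have e : VHSpan.cls π (VHSpan.ofCartesian S.base (inv S.v ≫ S.h) h) = S.cls π :=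
    Quotient.sound e
  rw [← e]
  exact isStronglyCartesian_ofCartesian S.base _ h

variable [CartesianMonoidalCategory B] [BraidedCategory B] {R : B} [CommRingObj R]

namespace VB

/-! ### Cartesian and invertible maps of vector bundles. -/

/-- A Cartesian map of vector bundles is a pullback square. -/
theorem isPullback_of_isStronglyCartesian {X Y : VB R} (t : X ⟶ Y)
    (h : (proj R).IsStronglyCartesian t.base t) :
    IsPullback t.total X.bundle.proj Y.bundle.proj t.base := by
  have h' := isStronglyCartesian_pullMap Y t.base
  -- Both `t` and the pullback map are Cartesian over `t.base`. The resulting isomorphism is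
  -- vertical, so its total arrow identifies the square of `t` with the chosen pullback square.
  let e := IsCartesian.domainUniqueUpToIso (proj R) t.base (Y.pullMap t.base) t
  have he : e.hom ≫ Y.pullMap t.base = t := by simp [e]
  have hv : (proj R).IsHomLift (𝟙 X.base) e.hom := inferInstance
  have hb : 𝟙 X.base = e.hom.base := 
    @CategoryTheory.IsHomLift.eq_of_isHomLift _ _ _ _ (proj R) X (Y.pull t.base) _ _ hv
  refine IsPullback.of_iso_pullback ⟨t.w⟩
    ⟨e.hom.total, e.inv.total, congrArg Hom.total e.hom_inv_id,
      congrArg Hom.total e.inv_hom_id⟩ (congrArg Hom.total he) ?_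
  refine e.hom.w.trans ?_
  rw [← hb, comp_id]

/-- A map of vector bundles is invertible if its base and total arrows are. -/
theorem isIso_of_isIso_total {X Y : VB R} (t : X ⟶ Y) [IsIso t.base] [IsIso t.total] :
    IsIso t := by
  have w : inv t.total ≫ X.bundle.proj = Y.bundle.proj ≫ inv t.base := by
    rw [IsIso.inv_comp_eq, ← assoc, IsIso.eq_comp_inv, t.w]
  have hmap : ∀ {T : B} {a : T ⟶ Y.base} (y : El Y.bundle.proj a),
      (El.map t.w (El.map w y)).val = y.val := fun y => by simp [El.map]
  let s : Y ⟶ X :=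
    { base := inv t.base
      total := inv t.total
      w := w
      -- The total arrow of `t` is mono, so linearity of the inverse can be checked after it, where
      -- it becomes linearity of `t`.
      map_add := fun T a y y' => El.ext (by
        rw [← cancel_mono t.total]
        have h := congrArg El.val (t.map_add _ (El.map w y) (El.map w y'))
        refine Eq.trans (b := (y + y').val) ?_ (Eq.trans ?_ h.symm)
        · simp [El.map]
        · exact add_val_congr (by simp) _ _ _ _ (hmap y).symm (hmap y').symm)
      map_smul := fun T a r y => El.ext (by
        rw [← cancel_mono t.total]
        have h := congrArg El.val (t.map_smul _ r (El.map w y))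
        refine Eq.trans (b := (r • y).val) ?_ (Eq.trans ?_ h.symm)
        · simp [El.map]
        · exact smul_val_congr (by simp) _ _ _ (hmap y).symm) }
  exact ⟨s, hom_ext (IsIso.hom_inv_id t.base) (IsIso.hom_inv_id t.total),
    hom_ext (IsIso.inv_hom_id t.base) (IsIso.inv_hom_id t.total)⟩

variable (D : ∀ X : VB R, FibrewiseLinearDual X.bundle)

/-! ### Transport of functionals along a Cartesian map. -/

/-- The lift of a generalized element of the codomain along a Cartesian map of vector bundles. -/
noncomputable def liftEl {X Y : VB R} {t : X ⟶ Y}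
    (ht : IsPullback t.total X.bundle.proj Y.bundle.proj t.base) {T : B} {a : T ⟶ X.base}
    (y : El Y.bundle.proj (a ≫ t.base)) : El X.bundle.proj a :=
  ⟨ht.lift y.val a y.w, ht.lift_snd _ _ _⟩

theorem liftEl_total {X Y : VB R} {t : X ⟶ Y}
    (ht : IsPullback t.total X.bundle.proj Y.bundle.proj t.base) {T : B} {a : T ⟶ X.base}
    (y : El Y.bundle.proj (a ≫ t.base)) : (liftEl ht y).val ≫ t.total = y.val :=
  ht.lift_fst _ _ _

/-- The uniqueness half of the pullback property. Linearity of the lift, its compatibility with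
change of stage, and the fact that lifting `t(x)` returns `x` all come from it. -/
theorem liftEl_eq {X Y : VB R} {t : X ⟶ Y}
    (ht : IsPullback t.total X.bundle.proj Y.bundle.proj t.base) {T : B} {a : T ⟶ X.base}
    (y : El Y.bundle.proj (a ≫ t.base)) (x : El X.bundle.proj a) (h : x.val ≫ t.total = y.val) :
    liftEl ht y = x :=
  El.ext (ht.hom_ext ((liftEl_total ht y).trans h.symm) ((liftEl ht y).w.trans x.w.symm))

/-- As `t` is fibrewise linear, the sum of the lifts is a lift of the sum; uniqueness does the rest.
-/
theorem liftEl_add {X Y : VB R} {t : X ⟶ Y}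
    (ht : IsPullback t.total X.bundle.proj Y.bundle.proj t.base) {T : B} {a : T ⟶ X.base}
    (y y' : El Y.bundle.proj (a ≫ t.base)) :
    liftEl ht (y + y') = liftEl ht y + liftEl ht y' := by
  apply liftEl_eq
  refine (congrArg El.val (t.map_add a (liftEl ht y) (liftEl ht y'))).trans ?_
  exact add_val_congr rfl _ _ _ _ (liftEl_total ht y) (liftEl_total ht y')

theorem liftEl_smul {X Y : VB R} {t : X ⟶ Y}
    (ht : IsPullback t.total X.bundle.proj Y.bundle.proj t.base) {T : B} {a : T ⟶ X.base}
    (r : T ⟶ R) (y : El Y.bundle.proj (a ≫ t.base)) :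
    liftEl ht (r • y) = r • liftEl ht y := by
  apply liftEl_eq
  refine (congrArg El.val (t.map_smul a r (liftEl ht y))).trans ?_
  exact smul_val_congr rfl _ _ _ (liftEl_total ht y)

/-- The functional on the fibre of `Y` over `a ≫ t.base` which an element of `X^†` over `a`
induces, for `t : X ⟶ Y` Cartesian. -/
noncomputable def pushFunctional {X Y : VB R} {t : X ⟶ Y}
    (ht : IsPullback t.total X.bundle.proj Y.bundle.proj t.base) {T : B} {a : T ⟶ X.base}
    (d : El (D X).dual.proj a) : Functional Y.bundle (a ≫ t.base) where
  toLin S f :=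
    { toFun := fun y => (D X).pair (f ≫ a) (d.restrict f)
        -- Only the bracketing of the base point of `y` changes, so that it lies over the image of
        -- `f ≫ a`.
        (liftEl ht (a := f ≫ a) ⟨y.val, y.w.trans (assoc _ _ _).symm⟩)
      map_add' := fun y y' => by
        rw [← _root_.map_add, ← liftEl_add]
        congr 2
        exact El.ext (add_val_congr (assoc _ _ _).symm _ _ _ _ rfl rfl)
      map_smul' := fun r y => by
        rw [RingHom.id_apply, ← _root_.map_smul, ← liftEl_smul]
        congr 2
        exact El.ext (smul_val_congr (assoc _ _ _).symm _ _ _ rfl) }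
  natural S' S g f y y' hy := by
    dsimp only [LinearMap.coe_mk, AddHom.coe_mk]
    rw [FibrewiseLinearDual.pair_eq_ev, FibrewiseLinearDual.pair_eq_ev,
      FibrewiseLinearDual.comp_ev]
    · refine FibrewiseLinearDual.ev_congr _ (assoc _ _ _) ?_ _ _
      -- Restricting the lift of `y` along `g` gives a lift of the restriction of `y`.
      refine congrArg El.val (liftEl_eq ht _
        (⟨g ≫ (liftEl ht _).val, ?_⟩ : El X.bundle.proj ((g ≫ f) ≫ a)) ?_)
      · rw [assoc, (liftEl ht _).w, assoc]
      · rw [assoc, liftEl_total]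
        exact hy.symm
    · simp only [assoc, (liftEl ht _).w, El.restrict, d.w]

/-- The action `X^† ⟶ Y^†` on duals of a Cartesian map `t : X ⟶ Y`, over `t.base`. -/
noncomputable def push {X Y : VB R} {t : X ⟶ Y}
    (ht : IsPullback t.total X.bundle.proj Y.bundle.proj t.base) :
    El (D Y).dual.proj ((D X).dual.proj ≫ t.base) :=
  -- The identity of the total object of `X^†` is the generic element, lying over the structure
  -- arrow. Pushing it forward determines the map on all elements.
  ((D Y).universal _ (pushFunctional D ht ⟨𝟙 _, id_comp _⟩)).choose

/-- The defining property of `push` is read at stage `d` on the element `t(x)`, whose lift is `x`.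
This is the adjunction formula `⟨push d, t(x)⟩ = ⟨d, x⟩`, the counterpart of `ev_dagVTotal`. -/
theorem ev_push {X Y : VB R} {t : X ⟶ Y}
    (ht : IsPullback t.total X.bundle.proj Y.bundle.proj t.base) {T : B}
    (d : T ⟶ (D X).dual.total) (x : T ⟶ X.bundle.total)
    (h : x ≫ X.bundle.proj = d ≫ (D X).dual.proj)
    (h' : (x ≫ t.total) ≫ Y.bundle.proj = (d ≫ (push D ht).val) ≫ (D Y).dual.proj) :
    (D Y).ev (d ≫ (push D ht).val) (x ≫ t.total) h' = (D X).ev d x h := by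
  have h'' : (x ≫ t.total) ≫ Y.bundle.proj = d ≫ (D X).dual.proj ≫ t.base := by
    rw [assoc, t.w, reassoc_of% h]
  have := ((D Y).universal _ (pushFunctional D ht ⟨𝟙 _, id_comp _⟩)).choose_spec.1 d
    ⟨x ≫ t.total, h''⟩
  rw [FibrewiseLinearDual.pair_eq_ev] at this
  refine Eq.trans ?_ (this.trans ?_)
  · rfl
  · dsimp only [pushFunctional, LinearMap.coe_mk, AddHom.coe_mk]
    rw [FibrewiseLinearDual.pair_eq_ev]
    refine FibrewiseLinearDual.ev_congr _ (comp_id _) ?_ _ _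
    exact congrArg El.val (liftEl_eq ht _ (⟨x, h⟩ : El X.bundle.proj _) rfl)

/-- The fibrewise transpose of a Cartesian map is invertible. -/
theorem isIso_dagV {X Y : VB R} (t : X ⟶ Y)
    (ht : IsPullback t.total X.bundle.proj Y.bundle.proj t.base) : IsIso (dagV D t) := by
  have hw := (dagVTotal D t).w
  -- The candidate inverse sends `d` to its push-forward, paired with its own base point.
  let m : (D X).dual.total ⟶ (pull (dag D Y) t.base).bundle.total :=
    Limits.pullback.lift (push D ht).val (D X).dual.proj (push D ht).w
  have hm : m ≫ (pullMap (dag D Y) t.base).total = (push D ht).val :=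
    Limits.pullback.lift_fst _ _ _
  have hm' : m ≫ (pull (dag D Y) t.base).bundle.proj = (D X).dual.proj :=
    Limits.pullback.lift_snd _ _ _
  have h1 : (dagVTotal D t).val ≫ m = 𝟙 _ := by
    refine Limits.pullback.hom_ext ?_ ?_
    · have hp : ((dagVTotal D t).val ≫ (push D ht).val) ≫ (D Y).dual.proj =
          (pullMap (dag D Y) t.base).total ≫ (D Y).dual.proj := by
        rw [assoc, (push D ht).w, reassoc_of% hw]
        exact (pullMap (dag D Y) t.base).w.symm
      refine (assoc _ _ _).trans (((congrArg (_ ≫ ·) hm).trans ?_).trans (id_comp _).symm)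
      -- Elements of `Y^†` are separated by pairing with elements of `Y`. Since `t` is Cartesian,
      -- each such `y` here is `t(x)`. With `τ` the transpose, `⟨push (τ z), t(x)⟩ = ⟨τ z, x⟩ = ⟨z,
      -- t(x)⟩`, where `z` on the right stands for its image in `Y^†`.
      refine congrArg El.val ((D Y).ext_pair
        (⟨_, hp⟩ : El (D Y).dual.proj _) ⟨(pullMap (dag D Y) t.base).total, rfl⟩ ?_)
      intro S f y
      have hy : y.val ≫ Y.bundle.proj =
          (f ≫ (pull (dag D Y) t.base).bundle.proj) ≫ t.base := by
        rw [y.w, assoc]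
        exact congrArg (f ≫ ·) (pullMap (dag D Y) t.base).w
      let x := liftEl ht (⟨y.val, hy⟩ : El Y.bundle.proj _)
      have hx : x.val ≫ t.total = y.val := liftEl_total ht _
      have hx' : x.val ≫ X.bundle.proj = (f ≫ (dagVTotal D t).val) ≫ (D X).dual.proj := by
        rw [x.w, assoc, hw]
      rw [FibrewiseLinearDual.pair_eq_ev, FibrewiseLinearDual.pair_eq_ev]
      have k : (x.val ≫ t.total) ≫ Y.bundle.proj =
          (f ≫ (pullMap (dag D Y) t.base).total) ≫ (D Y).dual.proj := by
        rw [hx, y.w, assoc]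
      have k' : (x.val ≫ t.total) ≫ Y.bundle.proj =
          ((f ≫ (dagVTotal D t).val) ≫ (push D ht).val) ≫ (D Y).dual.proj := by
        rw [k, assoc, ← hp]
        simp only [assoc]
      refine Eq.trans ?_ ((ev_push D ht _ _ hx' k').trans ((ev_dagVTotal D t f x.val hx' k).trans ?_))
      · exact FibrewiseLinearDual.ev_congr _ (assoc _ _ _).symm hx.symm _ _
      · exact FibrewiseLinearDual.ev_congr _ rfl hx _ _
    · exact (assoc _ _ _).trans (((congrArg (_ ≫ ·) hm').trans hw).trans (id_comp _).symm)
  have h2 : m ≫ (dagVTotal D t).val = 𝟙 _ := by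
    have hp : (m ≫ (dagVTotal D t).val) ≫ (D X).dual.proj = (D X).dual.proj := by
      rw [assoc, hw, hm']
    -- The same two formulas in the other order: `⟨τ (m d), x⟩ = ⟨push d, t(x)⟩ = ⟨d, x⟩`. The test
    -- elements already lie in `X`, so nothing has to be lifted.
    refine congrArg El.val ((D X).ext_pair
      (⟨_, hp⟩ : El (D X).dual.proj _) ⟨𝟙 _, id_comp _⟩ ?_)
    intro S f x
    rw [FibrewiseLinearDual.pair_eq_ev, FibrewiseLinearDual.pair_eq_ev]
    have k1 : x.val ≫ X.bundle.proj = ((f ≫ m) ≫ (dagVTotal D t).val) ≫ (D X).dual.proj := by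
      rw [x.w, assoc, assoc, hw, hm']
    have k3 : (x.val ≫ t.total) ≫ Y.bundle.proj = (f ≫ (push D ht).val) ≫ (D Y).dual.proj := by
      rw [assoc, t.w, ← assoc, x.w, assoc, assoc, (push D ht).w]
    have k2 : (x.val ≫ t.total) ≫ Y.bundle.proj =
        ((f ≫ m) ≫ (pullMap (dag D Y) t.base).total) ≫ (D Y).dual.proj := by
      rw [k3, assoc f m, hm]
    refine Eq.trans ?_ ((ev_dagVTotal D t (f ≫ m) x.val k1 k2).trans
      (Eq.trans ?_ ((ev_push D ht f x.val x.w k3).trans ?_)))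
    · exact FibrewiseLinearDual.ev_congr _ (assoc _ _ _).symm rfl _ _
    · exact FibrewiseLinearDual.ev_congr _ (by rw [assoc, hm]) rfl _ _
    · exact FibrewiseLinearDual.ev_congr _ (comp_id _).symm rfl _ _
  have hb : IsIso (dagV D t).base := inferInstanceAs (IsIso (𝟙 X.base))
  have htot : IsIso (dagV D t).total := ⟨m, h1, h2⟩
  exact isIso_of_isIso_total _

/-- The fibrewise linear dualization functor preserves Cartesian arrows. -/
theorem isCartesianFunctor_dagger : IsCartesianFunctor (dagger D) := by
  intro A A' α X X' h hh
  -- Replaces `α` by the base arrow of `h`, which is the base of `dagSpan D h` by definition.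
  obtain ⟨⟩ := hh.toIsHomLift
  have : IsIso (dagSpan D h).v :=
    isIso_dagV D h (isPullback_of_isStronglyCartesian h hh)
  exact VHSpan.isStronglyCartesian_cls (dagSpan D h)

end VB

end DaggerCartesian

end StarBundle

/-! ### Assembly of the three claims. -/

open CategoryTheory MonoidalCategory StarBundle
theorem mainTheorem8 {B : Type u} [Category.{v} B] [CartesianMonoidalCategory B]
    [BraidedCategory B] (R : B) [CommRingObj R]
    (D : ∀ X : VB R, FibrewiseLinearDual X.bundle) (c : Cleavage (VB.fibration R).p) :
    IsCartesianFunctor (VB.dagger D) ∧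
    ∃ d : Strength c c.dual (VB.dagger D),
      (∀ (Q : B) (X : VB R),
        comparison c c.dual (VB.dagger D) Q X ≫ d.app Q X = 𝟙 _ ∧
        d.app Q X ≫ comparison c c.dual (VB.dagger D) Q X = 𝟙 _) ∧
      ∀ (F : trivialFibration B ⥤ᵇ VB.fibration R) (t : Strength (trivialCleavage B) c F),
        ∃! s : Strength (trivialCleavage B) c.dual (BasedFunctor.comp F (VB.dagger D)),
          ∀ Q M : B, s.app Q M = d.app Q (F.obj M) ≫ (VB.dagger D).map (t.app Q M) := by
  have h := VB.isCartesianFunctor_dagger D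
  obtain ⟨d, hd⟩ := exists_strength_inverse_comparison c c.dual (VB.dagger D) h
  -- The components of `t.comp d` are the required composites by definition. Uniqueness is
  -- immediate, because the remaining fields of a strength are propositions.
  exact ⟨h, d, hd, fun F t => ⟨t.comp d, fun _ _ => rfl, fun s hs =>
    Strength.ext (funext fun Q => funext fun M => hs Q M)⟩⟩
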